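/- Let $p\ge 1$. Write the coordinates of $\mathbb{R}^{4p}$ as $\underline X=(x_1,y_1,\dots,x_{2p},y_{2p})$ and let $\mathbb{C}_{4p}$ be the complex Clifford algebra with generators $e_1,\dots,e_{4p}$, $e_\alpha e_\beta+e_\beta e_\alpha=-2\delta_{\alpha\beta}$. Put $\mathfrak f_k=-\tfrac12(e_{2k-1}-ie_{2k})$, $\mathfrak f_k^\dagger=\tfrac12(e_{2k-1}+ie_{2k})$, $z_k=x_k+iy_k$, $z_k^c=x_k-iy_k$ for $k=1,\dots,2p$. *Monogenicity.* Let $\mathbb I,\mathbb J$ be the linear maps with $\mathbb I[e_{2k-1}]=e_{2k}$, $\mathbb I[e_{2k}]=-e_{2k-1}$ for $1\le k\le 2p$, and $\mathbb J[e_{4j-3}]=e_{4j-1}$, $\mathbb J[e_{4j-2}]=-e_{4j}$, $\mathbb J[e_{4j-1}]=-e_{4j-3}$, $\mathbb J[e_{4j}]=e_{4j-2}$ for $1\le j\le p$, and let $\mathbb K=\mathbb J\circ\mathbb I$. A differentiable function $F$ on an open set $\Omega\subset\mathbb{R}^{4p}$ with values in $\mathbb{C}_{4p}$ (for instance in the spinor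 space $\mathbb{C}_{4p}I$, $I=\prod_{k=1}^{2p}\mathfrak f_k\mathfrak f_k^\dagger$) is called quaternionic monogenic in $\Omega$ if $\sum_{\alpha} A[e_\alpha]\,\partial_{X_\alpha}F=0$ in $\Omega$ for each $A\in\{\mathbf 1,\mathbb I,\mathbb J,\mathbb K\}$. *Kernels.* For a point $\underline X$ put $$\underline z=\sum_{k=1}^{2p} z_k\mathfrak f_k,\quad \underline z^\dagger=\sum_{k=1}^{2p} z_k^c\mathfrak f_k^\dagger,\quad \underline z^J=\sum_{j=1}^p\big(z_{2j}\mathfrak f_{2j-1}^\dagger-z_{2j-1}\mathfrak f_{2j}^\dagger\big),\quad \underline z^{\dagger J}=\sum_{j=1}^p\big(z_{2j}^c\mathfrak f_{2j-1}-z_{2j-1}^c\mathfrak f_{2j}\big),$$ $|\underline z|=|\underline X|$, and, with $a_{4p}$ the area of the unit sphere $S^{4p-1}$, $$E=\frac{2}{a_{4p}}\frac{\underline z}{|\underline z|^{4p}},\quad E^\dagger=\frac{2}{a_{4p}}\frac{\underline z^\dagger}{|\underline z|^{4p}},\quad E^J=\frac{2}{a_{4p}}\frac{\underline z^J}{|\underline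 z|^{4p}},\quad E^{\dagger J}=\frac{2}{a_{4p}}\frac{\underline z^{\dagger J}}{|\underline z|^{4p}},$$ all regarded as functions of $\underline z$. *Forms.* Let $\widehat{dz_k}$ (respectively $\widehat{dz_k^c}$) be the $(4p-1)$-form obtained from $dz_1\wedge dz_1^c\wedge\dots\wedge dz_{2p}\wedge dz_{2p}^c$ by omitting the factor $dz_k$ (respectively $dz_k^c$), and put $$d\sigma_{\underline z}=\sum_{k=1}^{2p}\mathfrak f_k^\dagger\,\widehat{dz_k},\qquad d\sigma_{\underline z^\dagger}=-\sum_{k=1}^{2p}\mathfrak f_k\,\widehat{dz_k^c},$$ $$d\sigma_{\underline z^J}=\sum_{j=1}^p\big(\mathfrak f_{2j-1}\widehat{dz_{2j}}-\mathfrak f_{2j}\widehat{dz_{2j-1}}\big),\qquad d\sigma_{\underline z^{\dagger J}}=-\sum_{j=1}^p\big(\mathfrak f_{2j-1}^\dagger\widehat{dz_{2j}^c}-\mathfrak f_{2j}^\dagger\widehat{dz_{2j-1}^c}\big).$$ **Statement.** Let $D\subset\mathbb{R}^{4p}$ be a bounded domain with smooth boundary $\partial D$, oriented as the boundary of $D$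 (outward normal first), and let $g$ be quaternionic monogenic in an open neighbourhood of $\overline D$. Let $\underline X$ be a point of the interior of $D$, with corresponding variable $\underline z$, and let $\underline v$ be the variable corresponding to $\underline Y\in\partial D$. Then $$g(\underline X)=\frac1{(-4)^p}\int_{\partial D}\big[E(\underline v-\underline z)\,d\sigma_{\underline v}+E^\dagger(\underline v-\underline z)\,d\sigma_{\underline v^\dagger}\big]\,g(\underline Y),$$ $$g(\underline X)=\frac1{(-4)^p}\int_{\partial D}\big[E^J(\underline v-\underline z)\,d\sigma_{\underline v^J}+E^{\dagger J}(\underline v-\underline z)\,d\sigma_{\underline v^{\dagger J}}\big]\,g(\underline Y),$$ $$\int_{\partial D}\big[E(\underline v-\underline z)\,d\sigma_{\underline v^\dagger}+E^\dagger(\underline v-\underline z)\,d\sigma_{\underline v}\big]\,g(\underline Y)=0,$$ $$\int_{\partial D}\big[E^J(\underline v-\underline z)\,d\sigma_{\underline v^{\dagger J}}+E^{\dagger J}(\underline v-\underline z)\,d\sigma_{\underline v^J}\big]\,g(\underline Y)=0,$$ all four integrands being integrable over $\partial D$. -/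

import Mathlib

noncomputable section

namespace QuatClifford

open MeasureTheory
open scoped ContDiff

/-- The space `ℝ^{4p}` with its Euclidean structure. The coordinates are ordered as
`(X_1, …, X_{4p}) = (x_1, y_1, x_2, y_2, …, x_{2p}, y_{2p})`, numbered from `0` here. -/
abbrev V (p : ℕ) : Type := EuclideanSpace ℝ (Fin (4 * p))

/-! ### The complex Clifford algebra -/

/-- The quadratic form `-(w_1² + ⋯ + w_{4p}²)` on `ℂ^{4p}`. -/
def negForm (p : ℕ) : QuadraticForm ℂ (Fin (4 * p) → ℂ) :=
  QuadraticMap.weightedSumSquares ℂ (fun _ => (-1 : ℂ))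

/-- The complex Clifford algebra `ℂ_{4p} = ℂ ⊗ ℝ_{0,4p}`: generators with `e_α² = -1`,
`e_α e_β + e_β e_α = 0` for `α ≠ β`. -/
abbrev Cl (p : ℕ) : Type := CliffordAlgebra (negForm p)

/-- The generator `e_α`. -/
def e {p : ℕ} (α : Fin (4 * p)) : Cl p := CliffordAlgebra.ι (negForm p) (Pi.single α 1)

/-- The coordinates of an element of `ℂ_{4p}` with respect to the basis indexed by the subsets
`A ⊆ {1, …, 4p}` (which corresponds to `e_{α_1} ∧ ⋯ ∧ e_{α_h}` in the exterior algebra). -/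
def coords (p : ℕ) : Cl p ≃ₗ[ℂ] EuclideanSpace ℂ (Finset (Fin (4 * p))) :=
  ((CliffordAlgebra.equivExterior (negForm p)).trans
    (Pi.basisFun ℂ (Fin (4 * p))).ExteriorAlgebra.equivFun).trans
      (WithLp.linearEquiv 2 ℂ (Finset (Fin (4 * p)) → ℂ)).symm

/-- The Euclidean norm `|a|² = ∑_A |a_A|²` on the finite-dimensional space `ℂ_{4p}`; it serves
only to speak of derivatives and integrals of functions with values in `ℂ_{4p}`. -/
instance instNormedAddCommGroupCl (p : ℕ) : NormedAddCommGroup (Cl p) :=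
  NormedAddCommGroup.induced (Cl p) (EuclideanSpace ℂ (Finset (Fin (4 * p))))
    (coords p).toLinearMap (coords p).injective

instance instNormedSpaceCl (p : ℕ) : NormedSpace ℂ (Cl p) :=
  NormedSpace.induced ℂ (Cl p) (EuclideanSpace ℂ (Finset (Fin (4 * p)))) (coords p).toLinearMap

/-! ### Indices -/

/-- The position of the real coordinate `x_k`. -/
def xi {p : ℕ} (k : Fin (2 * p)) : Fin (4 * p) := ⟨2 * k.1, by omega⟩

/-- The position of the real coordinate `y_k`. -/
def yi {p : ℕ} (k : Fin (2 * p)) : Fin (4 * p) := ⟨2 * k.1 + 1, by omega⟩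

/-- The first complex index (`2j-1` when counting from one) of the `j`-th pair. -/
def fst {p : ℕ} (j : Fin p) : Fin (2 * p) := ⟨2 * j.1, by omega⟩

/-- The second complex index (`2j` when counting from one) of the `j`-th pair. -/
def snd {p : ℕ} (j : Fin p) : Fin (2 * p) := ⟨2 * j.1 + 1, by omega⟩

/-! ### Quaternionic monogenic functions -/

/-- The partial derivative `∂_{X_α} F`. -/
def pd {p : ℕ} (α : Fin (4 * p)) (F : V p → Cl p) (X : V p) : Cl p :=
  fderiv ℝ F X (EuclideanSpace.single α 1)

/-- The Dirac operator `∂`. -/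
def dirac {p : ℕ} (F : V p → Cl p) (X : V p) : Cl p :=
  ∑ k : Fin (2 * p), (e (xi k) * pd (xi k) F X + e (yi k) * pd (yi k) F X)

/-- The rotated Dirac operator `∂_𝕀 = 𝕀[∂]`. -/
def diracI {p : ℕ} (F : V p → Cl p) (X : V p) : Cl p :=
  ∑ k : Fin (2 * p), (-(e (xi k) * pd (yi k) F X) + e (yi k) * pd (xi k) F X)

/-- The rotated Dirac operator `∂_𝕁 = 𝕁[∂]`. -/
def diracJ {p : ℕ} (F : V p → Cl p) (X : V p) : Cl p :=
  ∑ j : Fin p,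
    (-(e (xi (fst j)) * pd (xi (snd j)) F X) + e (yi (fst j)) * pd (yi (snd j)) F X
      + e (xi (snd j)) * pd (xi (fst j)) F X - e (yi (snd j)) * pd (yi (fst j)) F X)

/-- The rotated Dirac operator `∂_𝕂 = 𝕂[∂]`. -/
def diracK {p : ℕ} (F : V p → Cl p) (X : V p) : Cl p :=
  ∑ j : Fin p,
    (e (xi (fst j)) * pd (yi (snd j)) F X + e (yi (fst j)) * pd (xi (snd j)) F X
      - e (xi (snd j)) * pd (yi (fst j)) F X - e (yi (snd j)) * pd (xi (fst j)) F X)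

/-- `F` is quaternionic monogenic in the open set `Ω`: it is differentiable there and is
annihilated by the four Dirac operators. The values are allowed in the whole of `ℂ_{4p}`;
functions with values in spinor space, the left ideal `ℂ_{4p} I`, are included. -/
structure QuaternionicMonogenicOn {p : ℕ} (F : V p → Cl p) (Ω : Set (V p)) : Prop where
  differentiableOn : DifferentiableOn ℝ F Ω
  dirac_eq_zero : ∀ X ∈ Ω, dirac F X = 0
  diracI_eq_zero : ∀ X ∈ Ω, diracI F X = 0
  diracJ_eq_zero : ∀ X ∈ Ω, diracJ F X = 0
  diracK_eq_zero : ∀ X ∈ Ω, diracK F X = 0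

/-! ### Witt basis, hermitian vector variables, kernels -/

/-- The Witt basis vector `𝔣_k = -½ (e_{2k-1} - i e_{2k})`. -/
def f {p : ℕ} (k : Fin (2 * p)) : Cl p :=
  (-(1 / 2) : ℂ) • (e (xi k) - Complex.I • e (yi k))

/-- The Witt basis vector `𝔣_k† = ½ (e_{2k-1} + i e_{2k})`. -/
def fd {p : ℕ} (k : Fin (2 * p)) : Cl p :=
  (1 / 2 : ℂ) • (e (xi k) + Complex.I • e (yi k))

/-- The complex coordinate `z_k = x_k + i y_k`, which is also the 1-form `dz_k`. -/
def zc {p : ℕ} (k : Fin (2 * p)) : V p →ₗ[ℝ] ℂ where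
  toFun X := (X (xi k) : ℂ) + Complex.I * (X (yi k) : ℂ)
  map_add' X Y := by simp; ring
  map_smul' c X := by simp; ring

/-- The conjugate coordinate `z_k^c = x_k - i y_k`, which is also the 1-form `dz_k^c`. -/
def zcc {p : ℕ} (k : Fin (2 * p)) : V p →ₗ[ℝ] ℂ where
  toFun X := (X (xi k) : ℂ) - Complex.I * (X (yi k) : ℂ)
  map_add' X Y := by simp; ring
  map_smul' c X := by simp; ring

/-- `z = ∑ z_k 𝔣_k`, as a function of the point `X`. -/
def hz {p : ℕ} (X : V p) : Cl p := ∑ k : Fin (2 * p), zc k X • f k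

/-- `z† = ∑ z_k^c 𝔣_k†`. -/
def hzd {p : ℕ} (X : V p) : Cl p := ∑ k : Fin (2 * p), zcc k X • fd k

/-- `z^J = 𝕁[z] = ∑ (z_{2j} 𝔣_{2j-1}† - z_{2j-1} 𝔣_{2j}†)`. -/
def hzJ {p : ℕ} (X : V p) : Cl p :=
  ∑ j : Fin p, (zc (snd j) X • fd (fst j) - zc (fst j) X • fd (snd j))

/-- `z^{†J} = 𝕁[z†] = ∑ (z_{2j}^c 𝔣_{2j-1} - z_{2j-1}^c 𝔣_{2j})`. -/
def hzdJ {p : ℕ} (X : V p) : Cl p :=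
  ∑ j : Fin p, (zcc (snd j) X • f (fst j) - zcc (fst j) X • f (snd j))

/-- The area `a_{4p}` of the unit sphere in `ℝ^{4p}`. -/
def area (p : ℕ) : ℝ := (μHE[4 * p - 1] (Metric.sphere (0 : V p) 1)).toReal

/-- The scalar factor `(2 / a_{4p}) |z|^{-4p}`, where `|z|² = ∑ |z_k|² = |X|²`. -/
def kerFactor {p : ℕ} (X : V p) : ℂ := ((2 / area p / ‖X‖ ^ (4 * p) : ℝ) : ℂ)

/-- The kernel `E(z)`. -/
def kerE {p : ℕ} (X : V p) : Cl p := kerFactor X • hz X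

/-- The kernel `E†(z)`. -/
def kerEd {p : ℕ} (X : V p) : Cl p := kerFactor X • hzd X

/-- The kernel `E^J(z)`. -/
def kerEJ {p : ℕ} (X : V p) : Cl p := kerFactor X • hzJ X

/-- The kernel `E^{†J}(z)`. -/
def kerEdJ {p : ℕ} (X : V p) : Cl p := kerFactor X • hzdJ X

/-! ### Differential forms of degree `4p - 1` -/

/-- Constant-coefficient forms of degree `4p - 1` on `ℝ^{4p}` with values in `W`, i.e. the values
of such differential forms at a point. -/
abbrev TopForm (p : ℕ) (W : Type) [AddCommGroup W] [Module ℝ W] : Type :=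
  V p [⋀^Fin (4 * p - 1)]→ₗ[ℝ] W

/-- The wedge product `θ_1 ∧ ⋯ ∧ θ_k` of complex-valued 1-forms, with the convention
`(θ_1 ∧ ⋯ ∧ θ_k)(v_1, …, v_k) = det (θ_a(v_b))`. -/
def wedge {U : Type} [AddCommGroup U] [Module ℝ U] {k : ℕ} (θ : Fin k → U →ₗ[ℝ] ℂ) :
    U [⋀^Fin k]→ₗ[ℝ] ℂ where
  toFun v := Matrix.det (Matrix.of fun a b => θ a (v b))
  map_update_add' := by
    intro inst v b x y
    obtain rfl : inst = instDecidableEqFin k := Subsingleton.elim _ _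
    have h : ∀ u : U, (Matrix.of fun a b' => θ a (Function.update v b u b')) =
        Matrix.updateCol (Matrix.of fun a b' => θ a (v b')) b (fun a => θ a u) := by
      intro u
      ext a b'
      by_cases hb : b' = b
      · subst hb; simp
      · simp [hb]
    rw [h, h, h, ← Matrix.det_updateCol_add]
    congr 2
    ext a
    simp
  map_update_smul' := by
    intro inst v b c x
    obtain rfl : inst = instDecidableEqFin k := Subsingleton.elim _ _
    have h : ∀ u : U, (Matrix.of fun a b' => θ a (Function.update v b u b')) =
        Matrix.updateCol (Matrix.of fun a b' => θ a (v b')) b (fun a => θ a u) := by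
      intro u
      ext a b'
      by_cases hb : b' = b
      · subst hb; simp
      · simp [hb]
    rw [h, h, Complex.real_smul, ← Matrix.det_updateCol_smul]
    congr 2
    ext a
    simp
  map_eq_zero_of_eq' := by
    intro v i j hv hij
    exact Matrix.det_zero_of_column_eq hij (fun a => by simp [hv])

/-- The increasing enumeration of `{0, …, m-1} ∖ {j}`. -/
def skip {m : ℕ} (j : Fin m) (i : Fin (m - 1)) : Fin m :=
  if i.1 < j.1 then ⟨i.1, by omega⟩ else ⟨i.1 + 1, by omega⟩

/-- The sequence of 1-forms `dz_1, dz_1^c, dz_2, dz_2^c, …, dz_{2p}, dz_{2p}^c`. -/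
def dzSeq {p : ℕ} (a : Fin (4 * p)) : V p →ₗ[ℝ] ℂ :=
  if a.1 % 2 = 0 then zc ⟨a.1 / 2, by omega⟩ else zcc ⟨a.1 / 2, by omega⟩

/-- The form `\widehat{dz_k}`: the wedge product of the sequence `dz_1, dz_1^c, …, dz_{2p}^c`
with `dz_k` omitted. -/
def hatdz {p : ℕ} (k : Fin (2 * p)) : TopForm p ℂ := wedge fun i => dzSeq (skip (xi k) i)

/-- The form `\widehat{dz_k^c}`: the wedge product of the sequence `dz_1, dz_1^c, …, dz_{2p}^c`
with `dz_k^c` omitted. -/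
def hatdzc {p : ℕ} (k : Fin (2 * p)) : TopForm p ℂ := wedge fun i => dzSeq (skip (yi k) i)

/-- The Clifford-valued form `a η` for `a ∈ ℂ_{4p}` and a complex-valued form `η`. -/
def tens {p : ℕ} (a : Cl p) (η : TopForm p ℂ) : TopForm p (Cl p) :=
  ((LinearMap.toSpanSingleton ℂ (Cl p) a).restrictScalars ℝ).compAlternatingMap η

/-- `dσ_z = ∑ 𝔣_k† \widehat{dz_k}`. -/
def dσ (p : ℕ) : TopForm p (Cl p) := ∑ k : Fin (2 * p), tens (fd k) (hatdz k)

/-- `dσ_{z†} = -∑ 𝔣_k \widehat{dz_k^c}`. -/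
def dσd (p : ℕ) : TopForm p (Cl p) := -∑ k : Fin (2 * p), tens (f k) (hatdzc k)

/-- `dσ_{z^J} = ∑ (𝔣_{2j-1} \widehat{dz_{2j}} - 𝔣_{2j} \widehat{dz_{2j-1}})`. -/
def dσJ (p : ℕ) : TopForm p (Cl p) :=
  ∑ j : Fin p, (tens (f (fst j)) (hatdz (snd j)) - tens (f (snd j)) (hatdz (fst j)))

/-- `dσ_{z^{†J}} = -∑ (𝔣_{2j-1}† \widehat{dz_{2j}^c} - 𝔣_{2j}† \widehat{dz_{2j-1}^c})`. -/
def dσdJ (p : ℕ) : TopForm p (Cl p) :=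
  -∑ j : Fin p, (tens (fd (fst j)) (hatdzc (snd j)) - tens (fd (snd j)) (hatdzc (fst j)))

/-- The product `a η b` of a Clifford-valued form with Clifford numbers on both sides. -/
def sandwich {p : ℕ} (a : Cl p) (η : TopForm p (Cl p)) (b : Cl p) : TopForm p (Cl p) :=
  ((LinearMap.mulLeftRight ℂ (a, b)).restrictScalars ℝ).compAlternatingMap η

/-! ### Smooth domains and integration over the boundary -/

/-- `ρ` is a smooth defining function of `D` on the open neighbourhood `U` of `x`. -/
structure IsLocalDefiningFunction {p : ℕ} (D : Set (V p)) (x : V p) (U : Set (V p))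
    (ρ : V p → ℝ) : Prop where
  isOpen : IsOpen U
  mem : x ∈ U
  contDiffOn : ContDiffOn ℝ ∞ ρ U
  gradient_ne_zero : ∀ y ∈ U, gradient ρ y ≠ 0
  mem_iff : ∀ y ∈ U, y ∈ D ↔ ρ y < 0

/-- `D` has a smooth boundary: near each boundary point it is `{ρ < 0}` for a smooth `ρ` with
nowhere vanishing gradient. -/
def HasSmoothBoundary {p : ℕ} (D : Set (V p)) : Prop :=
  ∀ x ∈ frontier D, ∃ U ρ, IsLocalDefiningFunction D x U ρ

/-- `ν` is the outward unit normal `∇ρ / |∇ρ|` of `D` at `x`. -/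
def IsOutwardUnitNormal {p : ℕ} (D : Set (V p)) (x ν : V p) : Prop :=
  ∃ U ρ, IsLocalDefiningFunction D x U ρ ∧ ν = ‖gradient ρ x‖⁻¹ • gradient ρ x

open Classical in
/-- The outward unit normal of `D` at the boundary point `x` (it does not depend on the local
defining function). -/
def outwardNormal {p : ℕ} (D : Set (V p)) (x : V p) : V p :=
  if h : ∃ ν, IsOutwardUnitNormal D x ν then h.choose else 0

/-- The value of the form `η` on the oriented hyperplane with unit normal `ν`, that is
`η(t_1, …, t_{4p-1})` for any orthonormal `t_i` such that `(ν, t_1, …, t_{4p-1})` is a positively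
oriented orthonormal basis. It is computed as `(ν^♭ ∧ η)(ε_1, …, ε_{4p})` on the standard basis
`ε_α` of `ℝ^{4p}`. -/
def density {p : ℕ} (η : TopForm p (Cl p)) (ν : V p) : Cl p :=
  ∑ α : Fin (4 * p),
    ((-1 : ℂ) ^ (α : ℕ) * (ν α : ℂ)) • η (fun i => EuclideanSpace.single (skip α i) (1 : ℝ))

/-- Integrability of the form `η` over `∂D` with respect to the surface measure. -/
def BoundaryIntegrable {p : ℕ} (D : Set (V p)) (η : V p → TopForm p (Cl p)) : Prop :=
  IntegrableOn (fun Y => density (η Y) (outwardNormal D Y)) (frontier D) μHE[4 * p - 1]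

/-- The integral `∫_{∂D} η` of a form of degree `4p - 1` over `∂D`, oriented as the boundary
of `D` (outward normal first). -/
def boundaryIntegral {p : ℕ} (D : Set (V p)) (η : V p → TopForm p (Cl p)) : Cl p :=
  ∫ Y in frontier D, density (η Y) (outwardNormal D Y) ∂μHE[4 * p - 1]

/-- `[E(v-z) dσ_v + E†(v-z) dσ_{v†}] g(Y)`. -/
def reproForm {p : ℕ} (g : V p → Cl p) (X Y : V p) : TopForm p (Cl p) :=
  sandwich (kerE (Y - X)) (dσ p) (g Y) + sandwich (kerEd (Y - X)) (dσd p) (g Y)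

/-- `[E^J(v-z) dσ_{v^J} + E^{†J}(v-z) dσ_{v^{†J}}] g(Y)`. -/
def reproFormJ {p : ℕ} (g : V p → Cl p) (X Y : V p) : TopForm p (Cl p) :=
  sandwich (kerEJ (Y - X)) (dσJ p) (g Y) + sandwich (kerEdJ (Y - X)) (dσdJ p) (g Y)

/-- `[E(v-z) dσ_{v†} + E†(v-z) dσ_v] g(Y)`. -/
def crossForm {p : ℕ} (g : V p → Cl p) (X Y : V p) : TopForm p (Cl p) :=
  sandwich (kerE (Y - X)) (dσd p) (g Y) + sandwich (kerEd (Y - X)) (dσ p) (g Y)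

/-- `[E^J(v-z) dσ_{v^{†J}} + E^{†J}(v-z) dσ_{v^J}] g(Y)`. -/
def crossFormJ {p : ℕ} (g : V p → Cl p) (X Y : V p) : TopForm p (Cl p) :=
  sandwich (kerEJ (Y - X)) (dσdJ p) (g Y) + sandwich (kerEdJ (Y - X)) (dσJ p) (g Y)

end QuatClifford

end

noncomputable section

namespace QuatClifford

open MeasureTheory Filter Topology Set
open scoped ContDiff NNReal

/-! ### General lemmas on integrals and Hausdorff measures -/

/-! On a hyperplane with unit normal `ν` the forms `dσ`, `dσd`, `dσJ`, `dσdJ` have the densities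
`hzd ν`, `hz ν`, `hzdJ ν`, `hzJ ν`, all multiplied by `(-4)^p / 2`. Writing `v = Y - X`, each of the
four integrals is therefore `(-4)^p / a_{4p}` times the surface integral of `|v|^{-4p} (A₁(v) B₁(ν)
+ A₂(v) B₂(ν)) g(Y)`, with `A₁, B₁, A₂, B₂` linear maps chosen among `hz`, `hzd`, `hzJ`, `hzdJ`.

Two facts are needed. The Witt relations give `A₁(v) B₁(v) + A₂(v) B₂(v) = c |v|²`, with `c = 1` for
the two reproducing formulas and `c = 0` for the two others, where only squares of isotropic vectors
occur. Monogenicity gives `∑ B_i(ε_α) ∂_α g = 0`, since these sums are combinations of `∂` and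
`∂_𝕀`, or of `∂_𝕁` and `∂_𝕂`.

Let `P_α(v) = A₁(v) B₁(ε_α) + A₂(v) B₂(ε_α)`. The fields `F_α = (|v|² + ε)^{-2p} P_α(v) g` have no
singularity, and their divergence is `4pcε (|v|² + ε)^{-2p-1} g`. For `ε = t^{-2}` this is `c` times
an approximate identity applied to `g`. Letting `t → ∞` in the divergence theorem yields `c ·
peakMass · g(X)` (`integral_kernel_flux`). The same formula for the radial field and `g = 1` on the
unit ball shows that `peakMass` is the area of the sphere (`area_eq_peakMass`).

Since `g` is only assumed differentiable, the divergence theorem is needed for differentiable fields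
with continuous divergence, and with the Hausdorff measure on the boundary
(`integral_divergence_eq_integral_flux`). Near a boundary point a defining function is straightened
by a map close to an isometry, which gives the theorem up to an error `η ∫ |flux|`
(`exists_ball_divergence_estimate`). A partition of unity adds these errors up without loss, and `η`
is arbitrary. -/

/-- The integral of the divergence of a compactly supported differentiable vector field
vanishes. Only the divergence is required to be integrable. -/
theorem integral_divergence_eq_zero {n : ℕ} {W : Type*} [NormedAddCommGroup W] [NormedSpace ℝ W]
    [CompleteSpace W]
    {F : Fin n → EuclideanSpace ℝ (Fin n) → W}
    {F' : Fin n → EuclideanSpace ℝ (Fin n) → EuclideanSpace ℝ (Fin n) →L[ℝ] W}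
    (hF : ∀ i x, HasFDerivAt (F i) (F' i x) x) (hc : ∀ i, HasCompactSupport (F i))
    (hi : Integrable fun x => ∑ i, F' i x (EuclideanSpace.single i 1)) :
    ∫ x, ∑ i, F' i x (EuclideanSpace.single i 1) = 0 := by
  rcases n with _ | n
  · simp
  obtain ⟨R, hR⟩ : ∃ R : ℝ, ∀ i, ∀ x, R < ‖x‖ → x ∉ tsupport (F i) := by
    have h : IsCompact (⋃ i, tsupport (F i)) := isCompact_iUnion fun i => hc i
    obtain ⟨R, hR⟩ := h.isBounded.exists_norm_le
    exact ⟨R, fun i x hx hxs => absurd (hR x (mem_iUnion.2 ⟨i, hxs⟩)) (not_le.2 hx)⟩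
  have hF0 : ∀ i x, R < ‖x‖ → F i x = 0 := fun i x hx =>
    image_eq_zero_of_notMem_tsupport (hR i x hx)
  have hF'0 : ∀ i x, R < ‖x‖ → F' i x = 0 := by
    intro i x hx
    have h1 : F i =ᶠ[𝓝 x] fun _ => 0 := by
      filter_upwards [(isOpen_lt continuous_const continuous_norm).mem_nhds hx] with y hy
      exact hF0 i y hy
    exact ((hF i x).congr_of_eventuallyEq h1.symm).unique (hasFDerivAt_const 0 x)
  have hcoord : ∀ (x : Fin (n + 1) → ℝ) i, |x i| ≤ ‖WithLp.toLp 2 x‖ := fun x i =>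
    PiLp.norm_apply_le (WithLp.toLp 2 x) i
  set eL : EuclideanSpace ℝ (Fin (n + 1)) ≃L[ℝ] (Fin (n + 1) → ℝ) :=
    EuclideanSpace.equiv (Fin (n + 1)) ℝ with heL
  have hsymm : ∀ x, eL.symm x = WithLp.toLp 2 x := fun x => rfl
  have hmp : MeasurePreserving (WithLp.toLp 2 : (Fin (n + 1) → ℝ) → _) volume volume :=
    PiLp.volume_preserving_toLp (Fin (n + 1))
  have hme : MeasurableEmbedding (WithLp.toLp 2 : (Fin (n + 1) → ℝ) → _) :=
    (MeasurableEquiv.toLp 2 (Fin (n + 1) → ℝ)).measurableEmbedding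
  set r : ℝ := |R| + 1 with hr
  have hRr : R < r := by have := le_abs_self R; linarith
  have hr0 : 0 < r := by positivity
  -- The faces of the box `[-r, r]^{n+1}` consist of points of norm at least `r > R`, where the
  -- field vanishes, so only the volume term survives.
  have key := integral_divergence_of_hasFDerivAt_off_countable' (E := W)
    (fun _ : Fin (n + 1) => -r) (fun _ => r) (fun _ => by linarith)
    (fun i x => F i (eL.symm x)) (fun i x => F' i (eL.symm x) ∘L (eL.symm : _ →L[ℝ] _)) ∅
    countable_empty
    (fun i => (Continuous.comp (continuous_iff_continuousAt.2 fun x => (hF i x).continuousAt)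
      eL.symm.continuous).continuousOn)
    (fun x _ i => (hF i _).comp x eL.symm.hasFDerivAt)
    (by
      have := (hmp.integrable_comp_emb hme).2 hi
      refine IntegrableOn.congr_fun (Integrable.integrableOn this) (fun x _ => ?_)
        measurableSet_Icc
      simp [hsymm])
  rw [← hmp.integral_comp hme, ← setIntegral_eq_integral_of_forall_compl_eq_zero
    (s := Icc (fun _ : Fin (n + 1) => -r) (fun _ => r))]
  · have hz : ∀ i (x : Fin n → ℝ) (t : ℝ), |t| = r → F i (eL.symm (i.insertNth t x)) = 0 := by
      intro i x t ht
      apply hF0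
      refine hRr.trans_le ?_
      have := hcoord (i.insertNth t x) i
      simpa [ht, hsymm] using this
    simp only [hz _ _ r (abs_of_pos hr0), hz _ _ (-r) (by rw [abs_neg, abs_of_pos hr0])] at key
    simpa [hsymm] using key
  · intro x hx
    refine Finset.sum_eq_zero fun i _ => ?_
    rw [hF'0 i, _root_.zero_apply]
    by_contra hle
    apply hx
    have h := fun j => abs_le.1 (((hcoord x j).trans (not_lt.1 hle)).trans hRr.le)
    exact ⟨fun j => (h j).1, fun j => (h j).2⟩

/-- The Euclidean Hausdorff measure under Lipschitz maps. -/
theorem _root_.LipschitzOnWith.euclideanHausdorffMeasure_image_le {X Y : Type*} [EMetricSpace X]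
    [EMetricSpace Y] [MeasurableSpace X] [BorelSpace X] [MeasurableSpace Y] [BorelSpace Y]
    {K : ℝ≥0} {φ : X → Y} {s : Set X} (h : LipschitzOnWith K φ s) (d : ℕ) :
    μHE[d] (φ '' s) ≤ (K : ENNReal) ^ d * μHE[d] s := by
  rw [Measure.euclideanHausdorffMeasure_def, Measure.euclideanHausdorffMeasure_def,
    Measure.smul_apply, Measure.smul_apply, mul_smul_comm]
  have := h.hausdorffMeasure_image_le (d := d) (by positivity)
  rw [ENNReal.rpow_natCast] at this
  gcongr

/-- Integrals with respect to two comparable measures are close. -/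
theorem norm_integral_sub_integral_le_of_le_smul {α W : Type*} [MeasurableSpace α]
    [NormedAddCommGroup W] [NormedSpace ℝ W] {m μ : Measure α} [IsFiniteMeasure m] {c : ℝ≥0}
    (hc : 1 ≤ c) (h₁ : m ≤ c • μ) (h₂ : μ ≤ c • m) {φ : α → W} (hφ : Integrable φ μ) :
    ‖∫ x, φ x ∂m - ∫ x, φ x ∂μ‖ ≤ 3 * (c - 1) * ∫ x, ‖φ x‖ ∂μ := by
  have hφc : Integrable φ (c • μ) := hφ.smul_measure_nnreal
  have hφm : Integrable φ m := hφc.mono_measure h₁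
  have hadd := Measure.sub_add_cancel_of_le h₁
  have hφl : Integrable φ (c • μ - m) := hφc.mono_measure Measure.sub_le
  have e1 : ∫ x, φ x ∂(c • μ - m) = c • ∫ x, φ x ∂μ - ∫ x, φ x ∂m := by
    rw [eq_sub_iff_add_eq, ← integral_add_measure hφl hφm, hadd, integral_smul_nnreal_measure]
  have e2 : ∫ x, ‖φ x‖ ∂(c • μ - m) = c • ∫ x, ‖φ x‖ ∂μ - ∫ x, ‖φ x‖ ∂m := by
    rw [eq_sub_iff_add_eq, ← integral_add_measure hφl.norm hφm.norm, hadd,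
      integral_smul_nnreal_measure]
  have e3 : ∫ x, ‖φ x‖ ∂μ ≤ c * ∫ x, ‖φ x‖ ∂m := by
    have := integral_mono_measure h₂ (Eventually.of_forall fun x => norm_nonneg (φ x))
      hφm.norm.smul_measure_nnreal
    rwa [integral_smul_nnreal_measure] at this
  have hn : ‖∫ x, φ x ∂μ‖ ≤ ∫ x, ‖φ x‖ ∂μ := norm_integral_le_integral_norm _
  have hl : ‖∫ x, φ x ∂(c • μ - m)‖ ≤ ∫ x, ‖φ x‖ ∂(c • μ - m) := norm_integral_le_integral_norm _
  have hc' : (1 : ℝ) ≤ c := by exact_mod_cast hc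
  -- As `c μ - m` is a positive measure, the difference is at most `(c - 1) A + (c A - B)` with `A =
  -- ∫ |φ| dμ`, `B = ∫ |φ| dm`. From `B ≥ A / c ≥ (2 - c) A` comes the factor 3.
  have e4 : ∫ x, φ x ∂m - ∫ x, φ x ∂μ
      = ((c : ℝ) - 1) • ∫ x, φ x ∂μ - ∫ x, φ x ∂(c • μ - m) := by
    rw [e1, sub_smul, one_smul, NNReal.smul_def]; abel
  rw [e4]
  refine (norm_sub_le _ _).trans ?_
  rw [norm_smul, Real.norm_of_nonneg (by linarith)]
  rw [e2, NNReal.smul_def, smul_eq_mul] at hl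
  set A := ∫ x, ‖φ x‖ ∂μ
  set B := ∫ x, ‖φ x‖ ∂m
  have hA : 0 ≤ A := integral_nonneg fun _ => norm_nonneg _
  have hB : (2 - c) * A ≤ B := by
    have h1 : (2 - c) * A * c ≤ A := by nlinarith [mul_nonneg hA (sq_nonneg ((c : ℝ) - 1))]
    have hc0 : (0 : ℝ) < c := by linarith
    rcases le_or_gt (2 - (c : ℝ)) 0 with h | h
    · exact (mul_nonpos_of_nonpos_of_nonneg h hA).trans (integral_nonneg fun _ => norm_nonneg _)
    · by_contra hlt
      push Not at hlt
      nlinarith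
  nlinarith [mul_le_mul_of_nonneg_left hn (sub_nonneg.2 hc')]

/-! ### Integrals over thin slabs -/

section Slab

variable {E : Type*} [NormedAddCommGroup E] [InnerProductSpace ℝ E] {m : ℕ}

/-- Insertion of a zero as first coordinate. -/
def consZero (m : ℕ) : EuclideanSpace ℝ (Fin m) →ₗᵢ[ℝ] EuclideanSpace ℝ (Fin (m + 1)) where
  toFun x := WithLp.toLp 2 (Fin.cons 0 x.ofLp)
  map_add' x y := by ext i; refine Fin.cases ?_ (fun i => ?_) i <;> simp
  map_smul' c x := by ext i; refine Fin.cases ?_ (fun i => ?_) i <;> simp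
  norm_map' x := by simp [EuclideanSpace.norm_eq, Fin.sum_univ_succ]

/-- The isometric parametrization of the hyperplane orthogonal to `b 0`. -/
def hyperplaneMap (b : OrthonormalBasis (Fin (m + 1)) ℝ E) : EuclideanSpace ℝ (Fin m) →ₗᵢ[ℝ] E :=
  b.repr.symm.toLinearIsometry.comp (consZero m)

theorem inner_hyperplaneMap (b : OrthonormalBasis (Fin (m + 1)) ℝ E)
    (x : EuclideanSpace ℝ (Fin m)) :
    inner ℝ (b 0) (hyperplaneMap b x) = 0 := by
  rw [← OrthonormalBasis.repr_apply_apply]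
  simp [hyperplaneMap, consZero]

theorem exists_hyperplaneMap_eq (b : OrthonormalBasis (Fin (m + 1)) ℝ E) {y : E}
    (hy : inner ℝ (b 0) y = 0) : ∃ x, hyperplaneMap b x = y := by
  rw [← OrthonormalBasis.repr_apply_apply] at hy
  refine ⟨WithLp.toLp 2 (Fin.tail (b.repr y).ofLp), ?_⟩
  apply b.repr.injective
  ext i
  refine Fin.cases ?_ (fun i => ?_) i
  · simp [hyperplaneMap, consZero, hy]
  · simp [hyperplaneMap, consZero, Fin.tail]

variable [MeasurableSpace E] [BorelSpace E]

theorem measurableEmbedding_slab (b : OrthonormalBasis (Fin (m + 1)) ℝ E) :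
    MeasurableEmbedding
      (fun z : ℝ × EuclideanSpace ℝ (Fin m) => z.1 • b 0 + hyperplaneMap b z.2) := by
  apply Continuous.measurableEmbedding (by fun_prop)
  intro z w h
  have h0 := congrArg (fun y => inner ℝ (b 0) y) h
  simp only [inner_add_right, inner_smul_right, inner_hyperplaneMap] at h0
  simp only [real_inner_self_eq_norm_sq, b.orthonormal.1 0] at h0
  have h1 : z.1 = w.1 := by linarith
  simp only [h1] at h
  exact Prod.ext h1 ((hyperplaneMap b).injective (add_left_cancel h))

variable [FiniteDimensional ℝ E]

theorem measurePreserving_slab (b : OrthonormalBasis (Fin (m + 1)) ℝ E) :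
    MeasurePreserving (fun z : ℝ × EuclideanSpace ℝ (Fin m) => z.1 • b 0 + hyperplaneMap b z.2)
      volume volume := by
  have h1 : MeasurePreserving (Prod.map id WithLp.ofLp :
      ℝ × EuclideanSpace ℝ (Fin m) → ℝ × (Fin m → ℝ)) volume volume :=
    (MeasurePreserving.id volume).prod (PiLp.volume_preserving_ofLp (Fin m))
  have h2 := (volume_preserving_piFinSuccAbove (fun _ : Fin (m + 1) => ℝ) 0).symm
  have h3 := PiLp.volume_preserving_toLp (Fin (m + 1))
  have h := b.measurePreserving_repr_symm.comp (h3.comp (h2.comp h1))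
  convert h using 1
  funext z
  apply b.repr.injective
  ext i
  refine Fin.cases ?_ (fun i => ?_) i
  · simp [hyperplaneMap, consZero]
  · simp [hyperplaneMap, consZero]

/-- Averages over thin slabs around a hyperplane converge to the integral over the hyperplane. -/
theorem tendsto_integral_slab {W : Type*} [NormedAddCommGroup W] [NormedSpace ℝ W] [CompleteSpace W]
    (b : OrthonormalBasis (Fin (m + 1)) ℝ E) {k : ℝ → ℝ} (hk : Continuous k)
    (hks : HasCompactSupport k) (hk1 : ∫ t, k t = 1) {q : E → W} (hq : Continuous q)
    (hqs : HasCompactSupport q) :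
    Tendsto (fun δ : ℝ => ∫ y, (δ⁻¹ * k (δ⁻¹ * inner ℝ (b 0) y)) • q y) (𝓝[>] 0)
      (𝓝 (∫ x, q (hyperplaneMap b x))) := by
  -- `P t` is the integral over the parallel hyperplane at height `t`. After the substitution `t = δ
  -- s` the slab average is `∫ k(s) P(δ s) ds`, which is continuous in `δ` and equals `P 0` at `δ =
  -- 0`.
  set P : ℝ → W := fun t => ∫ x, q (t • b 0 + hyperplaneMap b x) with hP
  obtain ⟨R, hR⟩ := hqs.isCompact.isBounded.exists_norm_le
  have hnorm : ∀ (t : ℝ) x, ‖x‖ ≤ ‖t • b 0 + hyperplaneMap b x‖ := by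
    intro t x
    have h : ‖t • b 0 + hyperplaneMap b x‖ * ‖t • b 0 + hyperplaneMap b x‖ =
        ‖t • b 0‖ * ‖t • b 0‖ + ‖hyperplaneMap b x‖ * ‖hyperplaneMap b x‖ :=
      norm_add_sq_eq_norm_sq_add_norm_sq_of_inner_eq_zero _ _
        (by rw [inner_smul_left, inner_hyperplaneMap, mul_zero])
    rw [(hyperplaneMap b).norm_map] at h
    exact abs_le_of_sq_le_sq' (by nlinarith [mul_self_nonneg ‖t • b 0‖]) (norm_nonneg _) |>.2
  have hq0 : ∀ (t : ℝ) x, x ∉ Metric.closedBall (0 : EuclideanSpace ℝ (Fin m)) R →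
      q (t • b 0 + hyperplaneMap b x) = 0 := by
    intro t x hx
    apply image_eq_zero_of_notMem_tsupport
    intro h
    exact hx (by simpa using (hnorm t x).trans (hR _ h))
  -- By orthogonality one ball carries the integrand for all heights, which reduces continuity to a
  -- parametric integral over a compact set.
  have hPc : Continuous P := by
    have : P = fun t => ∫ x in Metric.closedBall (0 : EuclideanSpace ℝ (Fin m)) R,
        q (t • b 0 + hyperplaneMap b x) := by
      funext t
      exact (setIntegral_eq_integral_of_forall_compl_eq_zero (hq0 t)).symm
    rw [this]
    exact continuous_parametric_integral_of_continuous
      (f := fun t x => q (t • b 0 + hyperplaneMap b x)) (by fun_prop) (isCompact_closedBall 0 R)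
  have hQ : Continuous fun δ : ℝ => ∫ s, k s • P (δ * s) := by
    have : (fun δ : ℝ => ∫ s, k s • P (δ * s)) = fun δ => ∫ s in tsupport k, k s • P (δ * s) := by
      funext δ
      refine (setIntegral_eq_integral_of_forall_compl_eq_zero fun s hs => ?_).symm
      rw [image_eq_zero_of_notMem_tsupport hs, zero_smul]
    rw [this]
    exact continuous_parametric_integral_of_continuous
      (f := fun δ s => k s • P (δ * s)) (by fun_prop) hks
  have hlim := (hQ.tendsto 0).mono_left (nhdsWithin_le_nhds (s := Ioi 0))
  have h0 : ∫ s, k s • P (0 * s) = ∫ x, q (hyperplaneMap b x) := by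
    simp only [zero_mul, integral_smul_const, hk1, one_smul, hP, zero_smul, zero_add]
  rw [h0] at hlim
  refine hlim.congr' ?_
  filter_upwards [self_mem_nhdsWithin] with δ (hδ : 0 < δ)
  have hint : Integrable (fun y => (δ⁻¹ * k (δ⁻¹ * inner ℝ (b 0) y)) • q y) :=
    Continuous.integrable_of_hasCompactSupport (by fun_prop) hqs.smul_left
  rw [← (measurePreserving_slab b).integral_comp (measurableEmbedding_slab b)]
  have hint' := ((measurePreserving_slab b).integrable_comp_emb (measurableEmbedding_slab b)).2 hint
  rw [Measure.volume_eq_prod] at hint' ⊢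
  erw [integral_prod _ hint']
  have hin : ∀ (t : ℝ) x, inner ℝ (b 0) (t • b 0 + hyperplaneMap b x) = t := by
    intro t x
    rw [inner_add_right, inner_hyperplaneMap, inner_smul_right, real_inner_self_eq_norm_sq,
      b.orthonormal.1 0]
    ring
  simp only [Function.comp_def]
  simp only [hin, integral_smul]
  have := Measure.integral_comp_mul_left (fun t => (δ⁻¹ * k (δ⁻¹ * t)) • P t) δ
  simp only [← mul_assoc, inv_mul_cancel₀ hδ.ne', one_mul, abs_of_pos (inv_pos.2 hδ)] at this
  simp only [mul_smul, integral_smul] at this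
  have h2 := smul_right_injective W (inv_pos.2 hδ).ne' this
  rw [h2, ← integral_smul]
  simp only [hP, mul_smul]

end Slab

/-! ### Defining functions and the outward normal -/

section Normal

variable {p : ℕ} {D U : Set (V p)} {ρ : V p → ℝ} {x y : V p}

theorem IsLocalDefiningFunction.of_mem (h : IsLocalDefiningFunction D x U ρ) (hy : y ∈ U) :
    IsLocalDefiningFunction D y U ρ :=
  ⟨h.isOpen, hy, h.contDiffOn, h.gradient_ne_zero, h.mem_iff⟩

theorem IsLocalDefiningFunction.differentiableAt (h : IsLocalDefiningFunction D x U ρ) :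
    DifferentiableAt ℝ ρ x :=
  (h.contDiffOn.contDiffAt (h.isOpen.mem_nhds h.mem)).differentiableAt (by simp)

theorem IsLocalDefiningFunction.eq_zero (h : IsLocalDefiningFunction D x U ρ) (hD : IsOpen D)
    (hx : x ∈ frontier D) : ρ x = 0 := by
  rw [hD.frontier_eq] at hx
  refine le_antisymm ?_ (not_lt.1 fun hlt => hx.2 ((h.mem_iff x h.mem).2 hlt))
  by_contra! hpos
  have hev : ∀ᶠ z in 𝓝 x, 0 < ρ z ∧ z ∈ U :=
    (h.differentiableAt.continuousAt.eventually (lt_mem_nhds hpos)).and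
      (h.isOpen.mem_nhds h.mem)
  obtain ⟨z, hz, hzD⟩ := mem_closure_iff_nhds.1 hx.1 _ hev
  exact absurd ((h.mem_iff z hz.2).1 hzD) (not_lt.2 hz.1.le)

/-- A differentiable function vanishing at `x` is negative along directions in which it
decreases. -/
theorem eventually_neg_of_inner_gradient_neg {E : Type*} [NormedAddCommGroup E]
    [InnerProductSpace ℝ E] [CompleteSpace E] {ρ : E → ℝ} {x : E}
    (h : DifferentiableAt ℝ ρ x) (h0 : ρ x = 0) {w : E} (hw : inner ℝ (gradient ρ x) w < 0) :
    ∀ᶠ t : ℝ in 𝓝[>] 0, ρ (x + t • w) < 0 := by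
  have hd : HasDerivAt (fun t : ℝ => ρ (x + t • w)) (inner ℝ (gradient ρ x) w) 0 := by
    have h1 : HasFDerivAt ρ (InnerProductSpace.toDual ℝ E (gradient ρ x)) (x + (0 : ℝ) • w) := by
      simpa using h.hasGradientAt.hasFDerivAt
    have h2 : HasDerivAt (fun t : ℝ => x + t • w) w 0 := by
      simpa using ((hasDerivAt_id (0 : ℝ)).smul_const w).const_add x
    have h3 := h1.comp_hasDerivAt (0 : ℝ) h2
    rwa [InnerProductSpace.toDual_apply_apply] at h3
  have h3 := (hasDerivAt_iff_tendsto_slope.1 hd).mono_left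
    (nhdsWithin_mono 0 (fun t (ht : 0 < t) => ht.ne' : Ioi (0 : ℝ) ⊆ {0}ᶜ))
  filter_upwards [h3.eventually (gt_mem_nhds hw), self_mem_nhdsWithin] with t ht (ht0 : 0 < t)
  simp only [slope_def_field, sub_zero, zero_smul, add_zero, h0] at ht
  by_contra hle
  exact absurd ht (not_lt.2 (div_nonneg (not_lt.1 hle) ht0.le))

/-- A step from `x` along `-∇ρ` enters `D`. Together with `IsLocalDefiningFunction.eq_zero` this
identifies `∂D` with `{ρ = 0}` inside `U`. -/
theorem IsLocalDefiningFunction.mem_frontier (h : IsLocalDefiningFunction D x U ρ) (hD : IsOpen D)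
    (hx : ρ x = 0) : x ∈ frontier D := by
  rw [hD.frontier_eq]
  refine ⟨?_, fun hxD => absurd ((h.mem_iff x h.mem).1 hxD) (by simp [hx])⟩
  have hw : inner ℝ (gradient ρ x) (-gradient ρ x) < 0 := by
    have := h.gradient_ne_zero x h.mem
    rw [inner_neg_right, real_inner_self_eq_norm_sq, neg_lt_zero]
    exact pow_pos (norm_pos_iff.2 this) 2
  have ht : Tendsto (fun t : ℝ => x + t • -gradient ρ x) (𝓝[>] 0) (𝓝 x) := by
    have : Continuous fun t : ℝ => x + t • -gradient ρ x := by fun_prop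
    simpa using (this.tendsto 0).mono_left nhdsWithin_le_nhds
  refine mem_closure_of_tendsto ht ?_
  filter_upwards [eventually_neg_of_inner_gradient_neg h.differentiableAt hx hw,
    ht.eventually (h.isOpen.mem_nhds h.mem)] with t h1 h2
  exact (h.mem_iff _ h2).2 h1

/-- If the unit normals `a` and `b` differ, then `⟨a, b - a⟩ < 0 < ⟨b, b - a⟩`. Small steps along `b
- a` then have `ρ < 0` and `ρ' > 0`, so they would lie both in `D` and outside it. -/
theorem unitNormal_unique {U' : Set (V p)} {ρ' : V p → ℝ}
    (h : IsLocalDefiningFunction D x U ρ) (h' : IsLocalDefiningFunction D x U' ρ')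
    (hD : IsOpen D) (hx : x ∈ frontier D) :
    ‖gradient ρ x‖⁻¹ • gradient ρ x = ‖gradient ρ' x‖⁻¹ • gradient ρ' x := by
  have hg := norm_pos_iff.2 (h.gradient_ne_zero x h.mem)
  have hg' := norm_pos_iff.2 (h'.gradient_ne_zero x h'.mem)
  set a := ‖gradient ρ x‖⁻¹ • gradient ρ x with ha
  set b := ‖gradient ρ' x‖⁻¹ • gradient ρ' x with hb
  by_contra hne
  have hna : ‖a‖ = 1 := by rw [ha, norm_smul, norm_inv, norm_norm, inv_mul_cancel₀ hg.ne']
  have hnb : ‖b‖ = 1 := by rw [hb, norm_smul, norm_inv, norm_norm, inv_mul_cancel₀ hg'.ne']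
  have hab : inner ℝ a b < 1 := (inner_lt_one_iff_real_of_norm_eq_one hna hnb).2 hne
  have hwa : inner ℝ (gradient ρ x) (b - a) < 0 := by
    have e : gradient ρ x = ‖gradient ρ x‖ • a := by
      rw [ha, smul_smul, mul_inv_cancel₀ hg.ne', one_smul]
    rw [e, inner_smul_left, inner_sub_right, real_inner_self_eq_norm_sq, hna]
    simp only [conj_trivial]
    nlinarith
  have hwb : inner ℝ (gradient (fun z => -ρ' z) x) (b - a) < 0 := by
    have e : gradient (fun z => -ρ' z) x = -(‖gradient ρ' x‖ • b) := by
      rw [hb, smul_smul, mul_inv_cancel₀ hg'.ne', one_smul]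
      refine HasGradientAt.gradient ?_
      rw [hasGradientAt_iff_hasFDerivAt, map_neg]
      exact h'.differentiableAt.hasGradientAt.hasFDerivAt.neg
    rw [e, inner_neg_left, inner_smul_left, inner_sub_right, real_inner_self_eq_norm_sq, hnb,
      real_inner_comm]
    simp only [conj_trivial]
    nlinarith
  have ht : Tendsto (fun t : ℝ => x + t • (b - a)) (𝓝[>] 0) (𝓝 x) := by
    have : Continuous fun t : ℝ => x + t • (b - a) := by fun_prop
    simpa using (this.tendsto 0).mono_left nhdsWithin_le_nhds
  have h1 := eventually_neg_of_inner_gradient_neg h.differentiableAt (h.eq_zero hD hx) hwa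
  have h2 := eventually_neg_of_inner_gradient_neg (ρ := fun z => -ρ' z) h'.differentiableAt.neg
    (by simp [h'.eq_zero hD hx]) hwb
  obtain ⟨t, h1, h2, h3, h4⟩ := (h1.and (h2.and ((ht.eventually (h.isOpen.mem_nhds h.mem)).and
    (ht.eventually (h'.isOpen.mem_nhds h'.mem))))).exists
  have := (h'.mem_iff _ h4).1 ((h.mem_iff _ h3).2 h1)
  linarith

/-- The normal is defined by a choice; uniqueness allows computing it with any convenient defining
function. -/
theorem outwardNormal_eq (h : IsLocalDefiningFunction D x U ρ) (hD : IsOpen D)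
    (hx : x ∈ frontier D) : outwardNormal D x = ‖gradient ρ x‖⁻¹ • gradient ρ x := by
  have hex : ∃ ν, IsOutwardUnitNormal D x ν := ⟨_, U, ρ, h, rfl⟩
  rw [outwardNormal, dif_pos hex]
  obtain ⟨U', ρ', h', he⟩ := hex.choose_spec
  rw [he]
  exact unitNormal_unique h' h hD hx

theorem continuousOn_gradient {E : Type*} [NormedAddCommGroup E] [InnerProductSpace ℝ E]
    [CompleteSpace E] {ρ : E → ℝ} {U : Set E} (hU : IsOpen U) (h : ContDiffOn ℝ ∞ ρ U) :
    ContinuousOn (gradient ρ) U :=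
  (InnerProductSpace.toDual ℝ E).symm.continuous.comp_continuousOn
    (h.continuousOn_fderiv_of_isOpen hU (by simp))

theorem continuousOn_outwardNormal (hD : IsOpen D) (hs : HasSmoothBoundary D) :
    ContinuousOn (outwardNormal D) (frontier D) := by
  intro x hx
  obtain ⟨U, ρ, h⟩ := hs x hx
  have hU := h.isOpen.mem_nhds h.mem
  have hgc : ContinuousAt (gradient ρ) x :=
    (continuousOn_gradient h.isOpen h.contDiffOn).continuousAt hU
  have hc : ContinuousAt (fun y => ‖gradient ρ y‖⁻¹ • gradient ρ y) x :=
    (hgc.norm.inv₀ (norm_ne_zero_iff.2 (h.gradient_ne_zero x h.mem))).smul hgc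
  refine hc.continuousWithinAt.congr_of_eventuallyEq ?_ (outwardNormal_eq h hD hx)
  filter_upwards [self_mem_nhdsWithin, mem_nhdsWithin_of_mem_nhds hU] with y hy hyU
  exact outwardNormal_eq (h.of_mem hyU) hD hy

end Normal

/-! ### Flattening a hypersurface -/

section Flatten

variable {E : Type*} [NormedAddCommGroup E] [InnerProductSpace ℝ E]

/-- The map which replaces the coordinate in the direction `ν` by `ρ`. -/
def flatten (ν : E) (ρ : E → ℝ) (x₀ x : E) : E :=
  (x - x₀) + (ρ x - inner ℝ ν (x - x₀)) • ν

/-- The derivative of `flatten`. -/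
def flattenDeriv (ν : E) (ρ : E → ℝ) (x : E) : E →L[ℝ] E :=
  ContinuousLinearMap.id ℝ E + (fderiv ℝ ρ x - innerSL ℝ ν).smulRight ν

/-- Level sets of `ρ` go to hyperplanes orthogonal to `ν`; in particular the boundary becomes flat.
-/
theorem inner_flatten {ν : E} (hν : ‖ν‖ = 1) (ρ : E → ℝ) (x₀ x : E) :
    inner ℝ ν (flatten ν ρ x₀ x) = ρ x := by
  rw [flatten, inner_add_right, inner_smul_right, real_inner_self_eq_norm_sq, hν]
  ring

theorem hasStrictFDerivAt_flatten (ν : E) {ρ : E → ℝ} {x₀ x : E}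
    (h : HasStrictFDerivAt ρ (fderiv ℝ ρ x) x) :
    HasStrictFDerivAt (flatten ν ρ x₀) (flattenDeriv ν ρ x) x := by
  have h1 : HasStrictFDerivAt (fun x => x - x₀) (ContinuousLinearMap.id ℝ E) x :=
    (hasStrictFDerivAt_id x).sub_const x₀
  have h2 : HasStrictFDerivAt (fun x => inner ℝ ν (x - x₀)) (innerSL ℝ ν) x := by
    simpa using (innerSL ℝ ν).hasStrictFDerivAt.comp x h1
  exact h1.add ((h.sub h2).smul_const ν)

/-- Near a point where `∇ρ = ν` has norm one, the map `flatten` is close to a translation. -/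
theorem exists_flatten_approx [CompleteSpace E] [FiniteDimensional ℝ E] {ρ : E → ℝ} {U : Set E}
    {x₀ : E} (hU : IsOpen U) (hx₀ : x₀ ∈ U) (hρ : ContDiffOn ℝ ∞ ρ U)
    (hν : ‖gradient ρ x₀‖ = 1) {ε : ℝ≥0} (hε : 0 < ε) :
    ∃ r > 0, Metric.ball x₀ r ⊆ U ∧
      ApproximatesLinearOn (flatten (gradient ρ x₀) ρ x₀)
        ((ContinuousLinearEquiv.refl ℝ E : E ≃L[ℝ] E) : E →L[ℝ] E) (Metric.ball x₀ r) ε ∧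
      ∀ x ∈ Metric.ball x₀ r, (flattenDeriv (gradient ρ x₀) ρ x).det ≠ 0 ∧
        |‖gradient ρ x‖ / |(flattenDeriv (gradient ρ x₀) ρ x).det| - 1| ≤ ε := by
  set ν := gradient ρ x₀ with hνdef
  have hUx := hU.mem_nhds hx₀
  -- The correction term vanishes because `∇ρ(x₀) = ν`. All the claims then follow by continuity
  -- from their values at `x₀`.
  have hd0 : flattenDeriv ν ρ x₀ = ContinuousLinearMap.id ℝ E := by
    have h1 : fderiv ℝ ρ x₀ = innerSL ℝ ν := by
      have h := ((hρ.contDiffAt hUx).differentiableAt (by simp)).hasGradientAt.hasFDerivAt.fderiv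
      rw [h]
      ext w
      simp [hνdef]
    simp [flattenDeriv, h1]
  have hst := hasStrictFDerivAt_flatten (x₀ := x₀) ν
    ((hρ.contDiffAt hUx).hasStrictFDerivAt (by simp))
  rw [hd0] at hst
  obtain ⟨s, hs, happ⟩ := HasStrictFDerivAt.approximates_deriv_on_nhds hst (Or.inr hε)
  have hcf : ContinuousAt (fderiv ℝ ρ) x₀ :=
    (hρ.continuousOn_fderiv_of_isOpen hU (by simp)).continuousAt hUx
  have hcd : ContinuousAt (fun x => (flattenDeriv ν ρ x).det) x₀ := by
    refine ContinuousLinearMap.continuous_det.continuousAt.comp ?_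
    unfold flattenDeriv
    refine continuousAt_const.add ?_
    exact ((ContinuousLinearMap.smulRightL ℝ E E).flip ν).continuous.continuousAt.comp
      (hcf.sub continuousAt_const)
  have hdet0 : (flattenDeriv ν ρ x₀).det = 1 := by rw [hd0]; exact LinearMap.det_id
  have hcg : ContinuousAt (gradient ρ) x₀ := (continuousOn_gradient hU hρ).continuousAt hUx
  have hcq : ContinuousAt (fun x => ‖gradient ρ x‖ / |(flattenDeriv ν ρ x).det| - 1) x₀ :=
    (hcg.norm.div hcd.abs (by simp [hdet0])).sub continuousAt_const
  have hev : ∀ᶠ x in 𝓝 x₀, x ∈ U ∧ x ∈ s ∧ (flattenDeriv ν ρ x).det ≠ 0 ∧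
      |‖gradient ρ x‖ / |(flattenDeriv ν ρ x).det| - 1| < ε := by
    have h0 : |‖gradient ρ x₀‖ / |(flattenDeriv ν ρ x₀).det| - 1| < ε := by
      rw [hdet0, ← hνdef, hν]; simpa using hε
    exact (show ∀ᶠ x in 𝓝 x₀, x ∈ U from hUx).and
      ((show ∀ᶠ x in 𝓝 x₀, x ∈ s from hs).and ((hcd.eventually_ne (by simp [hdet0])).and
        (hcq.abs.eventually (gt_mem_nhds h0))))
  obtain ⟨r, hr, hball⟩ := Metric.eventually_nhds_iff_ball.1 hev
  exact ⟨r, hr, fun x hx => (hball x hx).1, happ.mono_set fun x hx => (hball x hx).2.1,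
    fun x hx => ⟨(hball x hx).2.2.1, (hball x hx).2.2.2.le⟩⟩

end Flatten

/-! ### The divergence theorem near a boundary point -/

/-- A smooth bump of integral one, supported in `[-1, 0]`. -/
def slabKernel (t : ℝ) : ℝ := deriv Real.smoothTransition (t + 1)

theorem hasDerivAt_smoothTransition (t : ℝ) :
    HasDerivAt (fun s => Real.smoothTransition (s + 1)) (slabKernel t) t := by
  have h : DifferentiableAt ℝ Real.smoothTransition (t + 1) :=
    (Real.smoothTransition.contDiff (n := 1)).differentiable (by simp) _
  exact h.hasDerivAt.comp_add_const t 1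

theorem continuous_slabKernel : Continuous slabKernel :=
  ((Real.smoothTransition.contDiff (n := 1)).continuous_deriv le_rfl).comp
    (continuous_add_const 1)

theorem slabKernel_eq_zero {t : ℝ} (ht : t ∉ Icc (-1 : ℝ) 0) : slabKernel t = 0 := by
  have h : ∀ c : ℝ, (fun s => Real.smoothTransition (s + 1)) =ᶠ[𝓝 t] (fun _ => c) →
      slabKernel t = 0 := fun c hc =>
    ((hasDerivAt_smoothTransition t).congr_of_eventuallyEq hc.symm).unique (hasDerivAt_const t c)
  rcases lt_or_ge t (-1) with h1 | h1
  · refine h 0 ?_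
    filter_upwards [gt_mem_nhds h1] with s hs
    exact Real.smoothTransition.zero_of_nonpos (by linarith)
  · have h2 : 0 < t := by
      by_contra h2
      exact ht ⟨h1, not_lt.1 h2⟩
    refine h 1 ?_
    filter_upwards [lt_mem_nhds h2] with s hs
    exact Real.smoothTransition.one_of_one_le (by linarith)

theorem hasCompactSupport_slabKernel : HasCompactSupport slabKernel :=
  HasCompactSupport.intro isCompact_Icc fun _ => slabKernel_eq_zero

theorem integral_slabKernel : ∫ t, slabKernel t = 1 := by
  rw [← setIntegral_eq_integral_of_forall_compl_eq_zero (fun t => slabKernel_eq_zero (t := t)),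
    integral_Icc_eq_integral_Ioc, ← intervalIntegral.integral_of_le (by norm_num),
    intervalIntegral.integral_eq_sub_of_hasDerivAt (fun t _ => hasDerivAt_smoothTransition t)
      (continuous_slabKernel.intervalIntegrable _ _)]
  simp

/-! ### Volume integrals as limits of integrals over thin layers -/

section Local

variable {n : ℕ} {W : Type*} [NormedAddCommGroup W] [NormedSpace ℝ W]
  {F : Fin n → EuclideanSpace ℝ (Fin n) → W}
  {F' : Fin n → EuclideanSpace ℝ (Fin n) → EuclideanSpace ℝ (Fin n) →L[ℝ] W}
  {K B : Set (EuclideanSpace ℝ (Fin n))}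

theorem fderiv_eq_zero_of_notMem (hF : ∀ i x, HasFDerivAt (F i) (F' i x) x) (hK : IsCompact K)
    (hF0 : ∀ i, ∀ x ∉ K, F i x = 0) (i : Fin n) {x : EuclideanSpace ℝ (Fin n)} (hx : x ∉ K) :
    F' i x = 0 := by
  have h1 : F i =ᶠ[𝓝 x] fun _ => 0 := by
    filter_upwards [hK.isClosed.isOpen_compl.mem_nhds hx] with y hy
    exact hF0 i y hy
  exact ((hF i x).congr_of_eventuallyEq h1.symm).unique (hasFDerivAt_const 0 x)

/-- A function vanishing off a compact subset of `B` and continuous on `B` is continuous. -/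
theorem continuous_of_continuousOn_of_eq_zero {X Y : Type*} [TopologicalSpace X] [T2Space X]
    [TopologicalSpace Y] [Zero Y] {φ : X → Y} {K B : Set X} (hB : IsOpen B) (hK : IsCompact K)
    (hKB : K ⊆ B) (hφ : ContinuousOn φ B) (h0 : ∀ x ∉ K, φ x = 0) : Continuous φ :=
  hφ.continuous_of_tsupport_subset hB
    ((closure_minimal (fun x (hx : φ x ≠ 0) => not_not.1 fun h => hx (h0 x h)) hK.isClosed).trans
      hKB)

variable [CompleteSpace W]

/-- The integral of the divergence over `{ρ < 0}` as a limit of integrals over thin layers. -/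
theorem tendsto_integral_layer (hF : ∀ i x, HasFDerivAt (F i) (F' i x) x) (hB : IsOpen B)
    (hK : IsCompact K) (hKB : K ⊆ B) (hF0 : ∀ i, ∀ x ∉ K, F i x = 0)
    (hdiv : Continuous fun x => ∑ i, F' i x (EuclideanSpace.single i 1))
    {ρ : EuclideanSpace ℝ (Fin n) → ℝ} (hρ : ContDiffOn ℝ ∞ ρ B) :
    Tendsto (fun δ : ℝ => ∫ x, (δ⁻¹ * slabKernel (δ⁻¹ * ρ x)) •
        ∑ i, fderiv ℝ ρ x (EuclideanSpace.single i 1) • F i x) (𝓝[>] 0)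
      (𝓝 (∫ x in B ∩ {x | ρ x < 0}, ∑ i, F' i x (EuclideanSpace.single i 1))) := by
  have hF'0 : ∀ i, ∀ x ∉ K, F' i x = 0 := fun i x hx => fderiv_eq_zero_of_notMem hF hK hF0 i hx
  set dv := fun x => ∑ i, F' i x (EuclideanSpace.single i 1) with hdv
  set nr := fun x => ∑ i, fderiv ℝ ρ x (EuclideanSpace.single i 1) • F i x with hnr
  have hdv0 : ∀ x ∉ K, dv x = 0 := fun x hx => by simp [hdv, hF'0 _ x hx]
  have hnr0 : ∀ x ∉ K, nr x = 0 := fun x hx => by simp [hnr, hF0 _ x hx]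
  have hFc : ∀ i, Continuous (F i) := fun i =>
    continuous_iff_continuousAt.2 fun x => (hF i x).continuousAt
  have hρc : ContinuousOn ρ B := hρ.continuousOn
  have hst : Continuous Real.smoothTransition :=
    (Real.smoothTransition.contDiff (n := 1)).continuous
  have hdvi : Integrable dv :=
    hdiv.integrable_of_hasCompactSupport (HasCompactSupport.intro hK hdv0)
  -- `θ(ρ/δ)` is a cutoff equal to 1 where `ρ ≤ -δ` and to 0 where `ρ ≥ 0`; it tends to the
  -- indicator of `{ρ < 0}` as `δ → 0`.
  set θ : ℝ → ℝ := fun t => 1 - Real.smoothTransition (t + 1) with hθ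
  have hθd : ∀ t, HasDerivAt θ (-slabKernel t) t := fun t => by
    simpa using (hasDerivAt_smoothTransition t).const_sub 1
  have hθc : Continuous θ := by fun_prop
  have hc1 : ∀ δ : ℝ, Continuous fun x => θ (δ⁻¹ * ρ x) • dv x := fun δ =>
    continuous_of_continuousOn_of_eq_zero hB hK hKB
      ((hθc.comp_continuousOn (continuousOn_const.mul hρc)).smul hdiv.continuousOn)
      (fun x hx => by rw [hdv0 x hx, smul_zero])
  have hnrc : ContinuousOn nr B := by
    refine continuousOn_finsetSum _ fun i _ => ContinuousOn.smul ?_ (hFc i).continuousOn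
    exact (hρ.continuousOn_fderiv_of_isOpen hB (by simp)).clm_apply continuousOn_const
  have hc2 : ∀ δ : ℝ, Continuous fun x => (δ⁻¹ * slabKernel (δ⁻¹ * ρ x)) • nr x := fun δ =>
    continuous_of_continuousOn_of_eq_zero hB hK hKB
      ((continuousOn_const.mul
        (continuous_slabKernel.comp_continuousOn (continuousOn_const.mul hρc))).smul hnrc)
      (fun x hx => by rw [hnr0 x hx, smul_zero])
  have hi1 : ∀ δ : ℝ, Integrable fun x => θ (δ⁻¹ * ρ x) • dv x := fun δ =>
    (hc1 δ).integrable_of_hasCompactSupport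
      (HasCompactSupport.intro hK fun x hx => by rw [hdv0 x hx, smul_zero])
  have hi2 : ∀ δ : ℝ, Integrable fun x => (δ⁻¹ * slabKernel (δ⁻¹ * ρ x)) • nr x := fun δ =>
    (hc2 δ).integrable_of_hasCompactSupport
      (HasCompactSupport.intro hK fun x hx => by rw [hnr0 x hx, smul_zero])
  -- The total divergence of the compactly supported field `θ(ρ/δ) F` is zero; the product rule
  -- produces the two sides.
  have key : ∀ δ : ℝ, ∫ x, (δ⁻¹ * slabKernel (δ⁻¹ * ρ x)) • nr x = ∫ x, θ (δ⁻¹ * ρ x) • dv x := by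
    intro δ
    have hG : ∀ i x, HasFDerivAt (fun x => θ (δ⁻¹ * ρ x) • F i x)
        (θ (δ⁻¹ * ρ x) • F' i x +
          (-(δ⁻¹ * slabKernel (δ⁻¹ * ρ x)) • fderiv ℝ ρ x).smulRight (F i x)) x := by
      intro i x
      by_cases hx : x ∈ K
      · have hd : HasFDerivAt ρ (fderiv ℝ ρ x) x :=
          ((hρ.contDiffAt (hB.mem_nhds (hKB hx))).differentiableAt (by simp)).hasFDerivAt
        have h1 := ((hθd (δ⁻¹ * ρ x)).comp_hasFDerivAt x (hd.const_mul δ⁻¹)).smul (hF i x)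
        have e : -(δ⁻¹ * slabKernel (δ⁻¹ * ρ x)) • fderiv ℝ ρ x =
            -slabKernel (δ⁻¹ * ρ x) • δ⁻¹ • fderiv ℝ ρ x := by
          rw [smul_smul]
          congr 1
          ring
        rw [e]
        exact h1
      -- Here `ρ` may fail to be differentiable, but the product vanishes in a neighbourhood of `x`.
      · rw [hF0 i x hx, hF'0 i x hx]
        have h1 : (fun x => θ (δ⁻¹ * ρ x) • F i x) =ᶠ[𝓝 x] fun _ => 0 := by
          filter_upwards [hK.isClosed.isOpen_compl.mem_nhds hx] with y hy
          rw [hF0 i y hy, smul_zero]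
        simpa using (hasFDerivAt_const (0 : W) x).congr_of_eventuallyEq h1
    have e : ∀ x, ∑ i, (θ (δ⁻¹ * ρ x) • F' i x +
          (-(δ⁻¹ * slabKernel (δ⁻¹ * ρ x)) • fderiv ℝ ρ x).smulRight (F i x))
            (EuclideanSpace.single i 1) =
        θ (δ⁻¹ * ρ x) • dv x - (δ⁻¹ * slabKernel (δ⁻¹ * ρ x)) • nr x := by
      intro x
      simp only [hdv, hnr, Finset.smul_sum, ← Finset.sum_sub_distrib]
      refine Finset.sum_congr rfl fun i _ => ?_
      simp [mul_smul, sub_eq_add_neg]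
    have h0 := integral_divergence_eq_zero hG
      (fun i => HasCompactSupport.intro hK fun x hx => by rw [hF0 i x hx, smul_zero])
      (by simp only [e]; exact (hi1 δ).sub (hi2 δ))
    simp only [e] at h0
    rw [integral_sub (hi1 δ) (hi2 δ)] at h0
    exact (sub_eq_zero.1 h0).symm
  change Tendsto (fun δ : ℝ => ∫ x, (δ⁻¹ * slabKernel (δ⁻¹ * ρ x)) • nr x) _ _
  simp only [key]
  have hmeas : MeasurableSet (B ∩ {x | ρ x < 0}) :=
    (hρc.isOpen_inter_preimage hB isOpen_Iio).measurableSet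
  rw [← integral_indicator hmeas]
  refine tendsto_integral_filter_of_dominated_convergence (fun x => ‖dv x‖)
    (Eventually.of_forall fun δ => (hc1 δ).aestronglyMeasurable) ?_ hdvi.norm ?_
  · refine Eventually.of_forall fun δ => Eventually.of_forall fun x => ?_
    rw [norm_smul]
    have h1 := Real.smoothTransition.nonneg (δ⁻¹ * ρ x + 1)
    have h2 := Real.smoothTransition.le_one (δ⁻¹ * ρ x + 1)
    refine mul_le_of_le_one_left (norm_nonneg _) ?_
    rw [Real.norm_eq_abs, abs_le]
    constructor <;> simp only [hθ] <;> linarith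
  · refine Eventually.of_forall fun x => ?_
    by_cases hx : x ∈ K
    · rcases lt_or_ge (ρ x) 0 with h | h
      · rw [indicator_of_mem (show x ∈ B ∩ {x | ρ x < 0} from ⟨hKB hx, h⟩)]
        refine tendsto_const_nhds.congr' ?_
        filter_upwards [Ioo_mem_nhdsGT (neg_pos.2 h)] with δ hδ
        have : δ⁻¹ * ρ x ≤ -1 := by
          rw [inv_mul_le_iff₀ hδ.1]
          linarith [hδ.2]
        simp only [hθ]
        rw [Real.smoothTransition.zero_of_nonpos (by linarith), sub_zero, one_smul]
      · rw [indicator_of_notMem (fun hm => absurd hm.2 (not_lt.2 h))]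
        refine tendsto_const_nhds.congr' ?_
        filter_upwards [self_mem_nhdsWithin] with δ (hδ : 0 < δ)
        have : 0 ≤ δ⁻¹ * ρ x := by positivity
        simp only [hθ]
        rw [Real.smoothTransition.one_of_one_le (by linarith), sub_self, zero_smul]
    · have h0 : (B ∩ {x | ρ x < 0}).indicator dv x = 0 := by
        by_cases hm : x ∈ B ∩ {x | ρ x < 0}
        · rw [indicator_of_mem hm, hdv0 x hx]
        · rw [indicator_of_notMem hm]
      rw [h0, hdv0 x hx]
      simp

end Local

/-! ### Surface measure and layer integrals in flattened coordinates -/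

section Flat

variable {E : Type*} [NormedAddCommGroup E] [InnerProductSpace ℝ E]
  [MeasurableSpace E] [BorelSpace E] {m : ℕ}

/-- The surface measure on a hypersurface and the measure transported from the hyperplane are
comparable. -/
theorem surfaceMeasure_comparable (b : OrthonormalBasis (Fin (m + 1)) ℝ E)
    (Φ : OpenPartialHomeomorph E E) {L : ℝ≥0} (h₁ : LipschitzOnWith L Φ Φ.source)
    (h₂ : LipschitzOnWith L Φ.symm Φ.target) :
    ((volume.restrict {x | hyperplaneMap b x ∈ Φ.target}).map
        (fun x => Φ.symm (hyperplaneMap b x)) ≤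
      L ^ m • (μHE[m]).restrict (Φ.source ∩ {x | inner ℝ (b 0) (Φ x) = 0})) ∧
    (μHE[m]).restrict (Φ.source ∩ {x | inner ℝ (b 0) (Φ x) = 0}) ≤
      L ^ m • (volume.restrict {x | hyperplaneMap b x ∈ Φ.target}).map
        (fun x => Φ.symm (hyperplaneMap b x)) := by
  set T : Set (EuclideanSpace ℝ (Fin m)) := {x | hyperplaneMap b x ∈ Φ.target} with hTdef
  set S := Φ.source ∩ {x | inner ℝ (b 0) (Φ x) = 0} with hS
  have hT : MeasurableSet T :=
    (Φ.open_target.preimage (hyperplaneMap b).continuous).measurableSet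
  have hG : AEMeasurable (fun x => Φ.symm (hyperplaneMap b x)) (volume.restrict T) :=
    (Φ.continuousOn_symm.comp (hyperplaneMap b).continuous.continuousOn
      (fun x hx => hx)).aemeasurable hT
  have hvol : ∀ Z : Set (EuclideanSpace ℝ (Fin m)), volume Z = μHE[m] (hyperplaneMap b '' Z) := by
    intro Z
    rw [(hyperplaneMap b).isometry.euclideanHausdorffMeasure_image,
      EuclideanSpace.euclideanHausdorffMeasure_eq_volume]
  have hset : ∀ A : Set E, hyperplaneMap b '' ((fun x => Φ.symm (hyperplaneMap b x)) ⁻¹' A ∩ T) =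
      Φ '' (A ∩ S) := by
    intro A
    ext y
    constructor
    · rintro ⟨x, ⟨hxA, hxT⟩, rfl⟩
      refine ⟨Φ.symm (hyperplaneMap b x), ⟨hxA, Φ.map_target hxT, ?_⟩, Φ.right_inv hxT⟩
      change inner ℝ (b 0) (Φ (Φ.symm (hyperplaneMap b x))) = 0
      rw [Φ.right_inv hxT, inner_hyperplaneMap]
    · rintro ⟨z, ⟨hzA, hzs, hz0⟩, rfl⟩
      obtain ⟨x, hx⟩ := exists_hyperplaneMap_eq b hz0
      refine ⟨x, ⟨?_, ?_⟩, hx⟩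
      · simpa only [mem_preimage, hx, Φ.left_inv hzs] using hzA
      · simpa only [hTdef, mem_ofPred_eq, hx] using Φ.map_source hzs
  -- The hyperplane is parametrized isometrically, so the transported measure of `A` is the
  -- Hausdorff measure of `Φ(A ∩ S)`. The two inequalities are then the Lipschitz bounds for `Φ` and
  -- its inverse.
  have hcalc : ∀ A, MeasurableSet A → ((volume.restrict T).map
      (fun x => Φ.symm (hyperplaneMap b x))) A = μHE[m] (Φ '' (A ∩ S)) := by
    intro A hA
    rw [Measure.map_apply_of_aemeasurable hG hA, Measure.restrict_apply' hT, hvol, hset]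
  constructor
  · refine Measure.le_iff.2 fun A hA => ?_
    rw [hcalc A hA, Measure.smul_apply, Measure.restrict_apply hA, ENNReal.smul_def]
    refine ((h₁.mono fun x hx => hx.2.1).euclideanHausdorffMeasure_image_le m).trans_eq ?_
    simp
  · refine Measure.le_iff.2 fun A hA => ?_
    rw [Measure.smul_apply, hcalc A hA, Measure.restrict_apply hA, ENNReal.smul_def]
    have h3 : Φ.symm '' (Φ '' (A ∩ S)) = A ∩ S := by
      rw [image_image]
      ext x
      constructor
      · rintro ⟨z, hz, rfl⟩
        simpa only [Φ.left_inv hz.2.1] using hz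
      · exact fun hx => ⟨x, hx, Φ.left_inv hx.2.1⟩
    have h4 : Φ '' (A ∩ S) ⊆ Φ.target := fun y ⟨x, hx, hxy⟩ => hxy ▸ Φ.map_source hx.2.1
    have h5 := (h₂.mono h4).euclideanHausdorffMeasure_image_le m
    rw [h3] at h5
    refine h5.trans_eq ?_
    simp

/-- Integrals over thin layers around a hypersurface, computed in coordinates which flatten it. -/
theorem tendsto_integral_flatten [FiniteDimensional ℝ E] {W : Type*} [NormedAddCommGroup W]
    [NormedSpace ℝ W] [CompleteSpace W] (b : OrthonormalBasis (Fin (m + 1)) ℝ E)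
    (Φ : OpenPartialHomeomorph E E)
    {Φ' : E → E →L[ℝ] E} (hΦ : ∀ x ∈ Φ.source, HasFDerivAt Φ (Φ' x) x)
    (hdet : ContinuousOn (fun x => (Φ' x).det) Φ.source) (hdet0 : ∀ x ∈ Φ.source, (Φ' x).det ≠ 0)
    {K : Set E} (hK : IsCompact K) (hKΦ : K ⊆ Φ.source)
    {φ : E → W} (hφ : ContinuousOn φ Φ.source) (hφ0 : ∀ x ∉ K, φ x = 0) :
    Tendsto (fun δ : ℝ => ∫ x, (δ⁻¹ * slabKernel (δ⁻¹ * inner ℝ (b 0) (Φ x))) • φ x) (𝓝[>] 0)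
      (𝓝 (∫ x in {x | hyperplaneMap b x ∈ Φ.target},
        |(Φ' (Φ.symm (hyperplaneMap b x))).det|⁻¹ • φ (Φ.symm (hyperplaneMap b x)))) := by
  set q : E → W := Φ.target.indicator fun y => |(Φ' (Φ.symm y)).det|⁻¹ • φ (Φ.symm y) with hq
  have hKc : IsCompact (Φ '' K) := hK.image_of_continuousOn (Φ.continuousOn.mono hKΦ)
  have hKt : Φ '' K ⊆ Φ.target := fun y ⟨x, hx, hxy⟩ => hxy ▸ Φ.map_source (hKΦ hx)
  have hq0 : ∀ y ∉ Φ '' K, q y = 0 := by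
    intro y hy
    by_cases hyt : y ∈ Φ.target
    · rw [hq, indicator_of_mem hyt, hφ0, smul_zero]
      exact fun h => hy ⟨_, h, Φ.right_inv hyt⟩
    · rw [hq, indicator_of_notMem hyt]
  have hqc : Continuous q := by
    refine continuous_of_continuousOn_of_eq_zero Φ.open_target hKc hKt ?_ hq0
    refine ContinuousOn.congr ?_ (fun y hy => indicator_of_mem hy _)
    have hs := Φ.continuousOn_symm
    have hm : MapsTo Φ.symm Φ.target Φ.source := Φ.mapsTo_symm
    exact (((hdet.comp hs hm).abs).inv₀ fun y hy => abs_ne_zero.2 (hdet0 _ (hm hy))).smul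
      (hφ.comp hs hm)
  have hlim := tendsto_integral_slab b continuous_slabKernel hasCompactSupport_slabKernel
    integral_slabKernel hqc (HasCompactSupport.intro hKc hq0)
  have hT : MeasurableSet {x | hyperplaneMap b x ∈ Φ.target} :=
    (Φ.open_target.preimage (hyperplaneMap b).continuous).measurableSet
  have e1 : ∫ x, q (hyperplaneMap b x) = ∫ x in {x | hyperplaneMap b x ∈ Φ.target},
      |(Φ' (Φ.symm (hyperplaneMap b x))).det|⁻¹ • φ (Φ.symm (hyperplaneMap b x)) := by
    rw [← integral_indicator hT]
    rfl
  rw [e1] at hlim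
  refine hlim.congr fun δ => ?_
  -- In the change of variables `y = Φ x` the Jacobian cancels the inverse determinant built into
  -- `q`.
  rw [← setIntegral_eq_integral_of_forall_compl_eq_zero (s := Φ.target)
      (fun y hy => by rw [hq, indicator_of_notMem hy, smul_zero]),
    ← setIntegral_eq_integral_of_forall_compl_eq_zero (s := Φ.source) (f := fun x => _ • φ x)
      (fun x hx => by rw [hφ0 x (fun h => hx (hKΦ h)), smul_zero]),
    ← Φ.image_source_eq_target,
    integral_image_eq_integral_abs_det_fderiv_smul volume Φ.open_source.measurableSet
      (fun x hx => (hΦ x hx).hasFDerivWithinAt) Φ.injOn]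
  refine setIntegral_congr_fun Φ.open_source.measurableSet fun x hx => ?_
  have hd := abs_ne_zero.2 (hdet0 x hx)
  simp only [hq, indicator_of_mem (Φ.map_source hx), Φ.left_inv hx]
  rw [smul_comm, smul_smul |(Φ' x).det|, mul_inv_cancel₀ hd, one_smul]

end Flat

/-! ### The divergence theorem on smooth domains -/

section Divergence

variable {p : ℕ} {D : Set (V p)}

/-- The flux density `∑ ν_α F_α` of a vector field through `∂D`. -/
def flux {W : Type*} [NormedAddCommGroup W] [NormedSpace ℝ W] (D : Set (V p))
    (F : Fin (4 * p) → V p → W) (x : V p) : W :=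
  ∑ i, outwardNormal D x i • F i x

/-- Dividing `ρ` by the constant `|∇ρ(x)|` keeps its sign. The normalization is what makes the
derivative of `flatten` at `x` the identity. -/
theorem exists_normalized_definingFunction (hs : HasSmoothBoundary D) {x : V p}
    (hx : x ∈ frontier D) :
    ∃ U ρ, IsLocalDefiningFunction D x U ρ ∧ ‖gradient ρ x‖ = 1 := by
  obtain ⟨U, ρ, h⟩ := hs x hx
  have hN := norm_pos_iff.2 (h.gradient_ne_zero x h.mem)
  set N := ‖gradient ρ x‖ with hNdef
  have hgr : ∀ y ∈ U, gradient (fun z => N⁻¹ * ρ z) y = N⁻¹ • gradient ρ y := by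
    intro y hy
    refine HasGradientAt.gradient ?_
    rw [hasGradientAt_iff_hasFDerivAt, map_smul]
    exact (h.of_mem hy).differentiableAt.hasGradientAt.hasFDerivAt.const_mul N⁻¹
  refine ⟨U, fun z => N⁻¹ * ρ z, ⟨h.isOpen, h.mem, contDiffOn_const.mul h.contDiffOn, ?_, ?_⟩, ?_⟩
  · intro y hy
    rw [hgr y hy]
    exact smul_ne_zero (inv_pos.2 hN).ne' (h.gradient_ne_zero y hy)
  · intro y hy
    rw [h.mem_iff y hy, mul_neg_iff]
    have := inv_pos.2 hN
    exact ⟨fun h => Or.inl ⟨this, h⟩, fun h => h.elim (·.2) fun h => absurd h.1 this.not_gt⟩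
  · rw [hgr x h.mem, norm_smul, norm_inv, norm_norm, ← hNdef, inv_mul_cancel₀ hN.ne']

theorem exists_orthonormalBasis_zero_eq {m : ℕ} {E : Type*} [NormedAddCommGroup E]
    [InnerProductSpace ℝ E] [FiniteDimensional ℝ E] (hE : Module.finrank ℝ E = m + 1) {ν : E}
    (hν : ‖ν‖ = 1) : ∃ b : OrthonormalBasis (Fin (m + 1)) ℝ E, b 0 = ν := by
  have h : Orthonormal ℝ (({0} : Set (Fin (m + 1))).domRestrict fun _ => ν) := by
    rw [orthonormal_iff_ite]
    rintro ⟨i, rfl⟩ ⟨j, rfl⟩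
    simp [hν]
  obtain ⟨b, hb⟩ := h.exists_orthonormalBasis_extension_of_card_eq (by simpa using hE)
  exact ⟨b, hb 0 rfl⟩

/-- An admissible radius for the comparison of Hausdorff measures. -/
theorem exists_approx_constant (m : ℕ) {η : ℝ} (hη : 0 < η) :
    ∃ ε : ℝ≥0, 0 < ε ∧ ε < 1 ∧
      (ε : ℝ) * ((1 - ε : ℝ)⁻¹) ^ m + 3 * (((1 - ε : ℝ)⁻¹) ^ m - 1) ≤ η := by
  -- With `L = (1 - ε)⁻¹`, the term `ε L^m` will bound the error in the density and `3 (L^m - 1)`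
  -- the error in the measure. The sum vanishes at `ε = 0`.
  have hc : ContinuousAt (fun ε : ℝ => ε * ((1 - ε)⁻¹) ^ m + 3 * (((1 - ε)⁻¹) ^ m - 1)) 0 := by
    have : ContinuousAt (fun ε : ℝ => (1 - ε)⁻¹) 0 :=
      ContinuousAt.inv₀ (by fun_prop) (by simp)
    fun_prop
  have h1 : ∀ᶠ ε : ℝ in 𝓝[>] 0, ε * ((1 - ε)⁻¹) ^ m + 3 * (((1 - ε)⁻¹) ^ m - 1) < η :=
    (hc.eventually (gt_mem_nhds (by simpa using hη))).filter_mono nhdsWithin_le_nhds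
  obtain ⟨ε, h2, h3⟩ := (h1.and (Ioo_mem_nhdsGT one_pos)).exists
  refine ⟨⟨ε, h3.1.le⟩, h3.1, h3.2, h2.le⟩

theorem continuousOn_flux {W : Type*} [NormedAddCommGroup W] [NormedSpace ℝ W]
    (hD : IsOpen D) (hs : HasSmoothBoundary D) {F : Fin (4 * p) → V p → W}
    (hF : ∀ i, ContinuousOn (F i) (frontier D)) : ContinuousOn (flux D F) (frontier D) := by
  refine continuousOn_finsetSum _ fun i _ => ContinuousOn.smul ?_ (hF i)
  have : Continuous fun v : V p => v i := by fun_prop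
  exact this.comp_continuousOn (continuousOn_outwardNormal hD hs)

theorem setIntegral_eq_setIntegral_inter {X W : Type*} [MeasurableSpace X] [NormedAddCommGroup W]
    [NormedSpace ℝ W] {μ : Measure X} {A B K : Set X} (hB : MeasurableSet B) (hKB : K ⊆ B)
    {ψ : X → W} (h0 : ∀ x ∉ K, ψ x = 0) : ∫ x in A, ψ x ∂μ = ∫ x in A ∩ B, ψ x ∂μ := by
  rw [inter_comm, ← Measure.restrict_restrict hB]
  exact (setIntegral_eq_integral_of_forall_compl_eq_zero fun x hx => h0 x fun h => hx (hKB h)).symm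

/-- The divergence theorem near a boundary point, up to a small relative error. -/
theorem exists_ball_divergence_estimate (hp : 1 ≤ p) (hD : IsOpen D) (hs : HasSmoothBoundary D)
    (W : Type*) [NormedAddCommGroup W] [NormedSpace ℝ W] [CompleteSpace W] {x₀ : V p}
    (hx₀ : x₀ ∈ frontier D) {η : ℝ} (hη : 0 < η) :
    ∃ r > 0, μHE[4 * p - 1] (frontier D ∩ Metric.ball x₀ r) < ⊤ ∧
      ∀ (F : Fin (4 * p) → V p → W) (F' : Fin (4 * p) → V p → V p →L[ℝ] W) (K : Set (V p)),
        (∀ i x, HasFDerivAt (F i) (F' i x) x) → IsCompact K → K ⊆ Metric.ball x₀ r →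
        (∀ i, ∀ x ∉ K, F i x = 0) →
        (Continuous fun x => ∑ i, F' i x (EuclideanSpace.single i 1)) →
        ‖(∫ x in D, ∑ i, F' i x (EuclideanSpace.single i 1)) -
            ∫ x in frontier D, flux D F x ∂μHE[4 * p - 1]‖ ≤
          η * ∫ x in frontier D, ‖flux D F x‖ ∂μHE[4 * p - 1] := by
  set m := 4 * p - 1 with hm
  obtain ⟨U, ρ, hdef, hν⟩ := exists_normalized_definingFunction hs hx₀
  obtain ⟨ε, hε0, hε1, hεη⟩ := exists_approx_constant m hη
  obtain ⟨r, hr, hrU, happ, hdet⟩ :=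
    exists_flatten_approx hdef.isOpen hdef.mem hdef.contDiffOn hν hε0
  set ν := gradient ρ x₀ with hνdef
  set B := Metric.ball x₀ r with hB
  obtain ⟨b, hb⟩ := exists_orthonormalBasis_zero_eq (m := m) (E := V p)
    (by simp [hm]; omega) hν
  have hε1' : (ε : ℝ) < 1 := hε1
  -- the flattening homeomorphism
  have hN : Subsingleton (V p) ∨
      ε < ‖(((ContinuousLinearEquiv.refl ℝ (V p)).symm : V p ≃L[ℝ] V p) :
        V p →L[ℝ] V p)‖₊⁻¹ := by
    right
    have hnt : Nontrivial (V p) := ⟨ν, 0, fun h => by simp [h] at hν⟩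
    have : ‖(((ContinuousLinearEquiv.refl ℝ (V p)).symm : V p ≃L[ℝ] V p) :
        V p →L[ℝ] V p)‖₊ = 1 := by
      have := ContinuousLinearMap.norm_id (𝕜 := ℝ) (E := V p)
      exact NNReal.eq this
    rwa [this, inv_one]
  set Φ := happ.toOpenPartialHomeomorph _ _ hN Metric.isOpen_ball with hΦ
  have hsrc : Φ.source = B := rfl
  have hΦc : ∀ x, Φ x = flatten ν ρ x₀ x := fun x => rfl
  have hin : ∀ x, inner ℝ (b 0) (Φ x) = ρ x := fun x => by rw [hb, hΦc, inner_flatten hν]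
  have hclose : ∀ x ∈ B, ∀ y ∈ B, ‖Φ x - Φ y - (x - y)‖ ≤ ε * ‖x - y‖ := fun x hx y hy =>
    happ x hx y hy
  -- Lipschitz bounds
  set L : ℝ≥0 := (1 - ε)⁻¹ with hL
  have hLr : (L : ℝ) = (1 - ε : ℝ)⁻¹ := by
    rw [hL, NNReal.coe_inv, NNReal.coe_sub hε1.le, NNReal.coe_one]
  have hε2 : (0 : ℝ) < 1 - ε := by linarith
  have hL1 : (1 : ℝ) ≤ L := by
    rw [hLr]
    exact (one_le_inv₀ hε2).2 (by linarith [ε.2])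
  -- Since `(1 + ε)(1 - ε) ≤ 1`, the constant `L` of the inverse map also serves for `Φ` itself.
  have hL2 : 1 + (ε : ℝ) ≤ L := by
    rw [hLr, le_inv_comm₀ (by positivity) hε2, inv_eq_one_div, le_div_iff₀ (by positivity)]
    nlinarith [sq_nonneg (ε : ℝ)]
  have hlip1 : LipschitzOnWith L Φ Φ.source := by
    refine LipschitzOnWith.of_dist_le_mul fun x hx y hy => ?_
    rw [dist_eq_norm, dist_eq_norm]
    calc ‖Φ x - Φ y‖ = ‖(Φ x - Φ y - (x - y)) + (x - y)‖ := by rw [sub_add_cancel]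
      _ ≤ ε * ‖x - y‖ + ‖x - y‖ := (norm_add_le _ _).trans (by gcongr; exact hclose x hx y hy)
      _ = (1 + ε) * ‖x - y‖ := by ring
      _ ≤ L * ‖x - y‖ := by gcongr
  have hlip2 : LipschitzOnWith L Φ.symm Φ.target := by
    refine LipschitzOnWith.of_dist_le_mul fun y hy z hz => ?_
    rw [dist_eq_norm, dist_eq_norm]
    have h1 := hclose _ (Φ.map_target hy) _ (Φ.map_target hz)
    rw [Φ.right_inv hy, Φ.right_inv hz] at h1
    set u := Φ.symm y - Φ.symm z
    have h2 : ‖u‖ ≤ ‖y - z‖ + ε * ‖u‖ := by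
      calc ‖u‖ = ‖(y - z) - (y - z - u)‖ := by rw [sub_sub_cancel]
        _ ≤ ‖y - z‖ + ‖y - z - u‖ := norm_sub_le _ _
        _ ≤ _ := by gcongr
    rw [hLr, le_inv_mul_iff₀ hε2]
    linarith
  obtain ⟨hm1, hm2⟩ := surfaceMeasure_comparable b Φ hlip1 hlip2
  set T : Set (EuclideanSpace ℝ (Fin m)) := {x | hyperplaneMap b x ∈ Φ.target} with hT
  set G : EuclideanSpace ℝ (Fin m) → V p := fun x => Φ.symm (hyperplaneMap b x) with hG
  have hTm : MeasurableSet T :=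
    (Φ.open_target.preimage (hyperplaneMap b).continuous).measurableSet
  have hGm : AEMeasurable G (volume.restrict T) :=
    (Φ.continuousOn_symm.comp (hyperplaneMap b).continuous.continuousOn
      (fun x hx => hx)).aemeasurable hTm
  -- Boundedness of the flat piece makes its Lebesgue measure finite, and by comparison also the
  -- Hausdorff measure of the piece of `∂D`.
  have hTb : Bornology.IsBounded T := by
    obtain ⟨R, hR⟩ : ∃ R, ∀ y ∈ Φ.target, ‖y‖ ≤ R := by
      refine ⟨‖Φ x₀‖ + L * r, fun y hy => ?_⟩
      have h1 := hlip1.dist_le_mul _ (Φ.map_target hy) x₀ (Metric.mem_ball_self hr)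
      rw [Φ.right_inv hy, dist_eq_norm] at h1
      have h2 : dist (Φ.symm y) x₀ ≤ r := (Metric.mem_ball.1 (Φ.map_target hy)).le
      have h3 : ‖y‖ ≤ ‖Φ x₀‖ + ‖y - Φ x₀‖ := norm_le_norm_add_norm_sub' y (Φ x₀)
      nlinarith [mul_le_mul_of_nonneg_left h2 L.2]
    refine (Metric.isBounded_closedBall (x := (0 : EuclideanSpace ℝ (Fin m))) (r := R)).subset ?_
    intro x hx
    simpa using hR _ hx
  have hfin : IsFiniteMeasure (volume.restrict T) := ⟨by
    rw [Measure.restrict_apply_univ]; exact hTb.measure_lt_top⟩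
  set M := (volume.restrict T).map G with hM
  have hMfin : IsFiniteMeasure M := Measure.isFiniteMeasure_map _ _
  have hS : Φ.source ∩ {x | inner ℝ (b 0) (Φ x) = 0} = frontier D ∩ B := by
    ext x
    simp only [hin, hsrc, mem_inter_iff, mem_ofPred_eq]
    constructor
    · exact fun h => ⟨(hdef.of_mem (hrU h.1)).mem_frontier hD h.2, h.1⟩
    · exact fun h => ⟨h.2, (hdef.of_mem (hrU h.2)).eq_zero hD h.1⟩
  rw [hS] at hm1 hm2
  set μ := (μHE[m] : Measure (V p)).restrict (frontier D ∩ B) with hμ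
  have hμfin : IsFiniteMeasure μ :=
    ⟨(hm2 univ).trans_lt (by
      rw [Measure.smul_apply]
      exact ENNReal.mul_lt_top ENNReal.coe_lt_top (measure_lt_top M univ))⟩
  refine ⟨r, hr, by simpa [hμ] using measure_lt_top μ univ, ?_⟩
  intro F F' K hF hK hKB hF0 hdiv
  have hSm : MeasurableSet (frontier D ∩ B) :=
    isClosed_frontier.measurableSet.inter Metric.isOpen_ball.measurableSet
  have hFc : ∀ i, Continuous (F i) := fun i =>
    continuous_iff_continuousAt.2 fun x => (hF i x).continuousAt
  set φ := flux D F with hφ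
  have hφ0 : ∀ x ∉ K, φ x = 0 := fun x hx => by simp [hφ, flux, hF0 _ x hx]
  have hφc : ContinuousOn φ (frontier D ∩ B) :=
    (continuousOn_flux hD hs fun i => (hFc i).continuousOn).mono inter_subset_left
  have hφi : Integrable φ μ := by
    obtain ⟨C, hC⟩ : ∃ C, ∀ x ∈ K ∩ frontier D, ‖φ x‖ ≤ C :=
      (hK.inter_right isClosed_frontier).exists_bound_of_continuousOn
        (hφc.mono fun x hx => ⟨hx.2, hKB hx.1⟩)
    refine Integrable.of_bound (hφc.aestronglyMeasurable hSm) (max C 0) ?_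
    refine (ae_restrict_iff' hSm).2 (Eventually.of_forall fun x hx => ?_)
    by_cases hxK : x ∈ K
    · exact (hC x ⟨hxK, hx.1⟩).trans (le_max_left _ _)
    · rw [hφ0 x hxK, norm_zero]; exact le_max_right _ _
  -- the volume integral
  have hDB : ∫ x in D, ∑ i, F' i x (EuclideanSpace.single i 1) =
      ∫ x in B ∩ {x | ρ x < 0}, ∑ i, F' i x (EuclideanSpace.single i 1) := by
    have e : B ∩ {x | ρ x < 0} = B ∩ D := by
      ext x
      constructor
      · exact fun h => ⟨h.1, (hdef.mem_iff x (hrU h.1)).2 h.2⟩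
      · exact fun h => ⟨h.1, (hdef.mem_iff x (hrU h.1)).1 h.2⟩
    rw [e, ← Measure.restrict_restrict Metric.isOpen_ball.measurableSet]
    refine (setIntegral_eq_integral_of_forall_compl_eq_zero fun x hx => ?_).symm
    refine Finset.sum_eq_zero fun i _ => ?_
    rw [fderiv_eq_zero_of_notMem hF hK hF0 i (fun h => hx (hKB h))]
    rfl
  have hρB : ContDiffOn ℝ ∞ ρ B := hdef.contDiffOn.mono hrU
  set N : V p → W := fun x => ∑ i, fderiv ℝ ρ x (EuclideanSpace.single i 1) • F i x with hNdef
  have hNc : ContinuousOn N B := by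
    refine continuousOn_finsetSum _ fun i _ => ContinuousOn.smul ?_ (hFc i).continuousOn
    exact (hρB.continuousOn_fderiv_of_isOpen Metric.isOpen_ball (by simp)).clm_apply
      continuousOn_const
  have hN0 : ∀ x ∉ K, N x = 0 := fun x hx => by simp [hNdef, hF0 _ x hx]
  have hdetc : ContinuousOn (fun x => (flattenDeriv ν ρ x).det) Φ.source := by
    refine ContinuousLinearMap.continuous_det.comp_continuousOn ?_
    unfold flattenDeriv
    refine continuousOn_const.add ?_
    exact ((ContinuousLinearMap.smulRightL ℝ (V p) (V p)).flip ν).continuous.comp_continuousOn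
      ((hρB.continuousOn_fderiv_of_isOpen Metric.isOpen_ball (by simp)).sub continuousOn_const)
  have hlim1 := tendsto_integral_layer hF Metric.isOpen_ball hK hKB hF0 hdiv hρB
  have hlim2 := tendsto_integral_flatten b Φ (Φ' := flattenDeriv ν ρ)
    (fun x hx => (hasStrictFDerivAt_flatten ν ((hρB.contDiffAt
      (Metric.isOpen_ball.mem_nhds hx)).hasStrictFDerivAt (by simp))).hasFDerivAt)
    hdetc (fun x hx => (hdet x hx).1) hK hKB hNc hN0
  simp only [hin] at hlim2
  -- The same layer integrals converge to the volume integral and to an integral over the flat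
  -- hyperplane.
  have hvol := tendsto_nhds_unique hlim1 hlim2
  -- on the boundary the integrand is nearly the flux
  set a : V p → ℝ := fun x => ‖gradient ρ x‖ / |(flattenDeriv ν ρ x).det| with ha
  have hNφ : ∀ x ∈ frontier D ∩ B, |(flattenDeriv ν ρ x).det|⁻¹ • N x = a x • φ x := by
    intro x hx
    have hd := hdef.of_mem (hrU hx.2)
    have hgn := norm_ne_zero_iff.2 (hd.gradient_ne_zero x hd.mem)
    have e : N x = ‖gradient ρ x‖ • φ x := by
      simp only [hNdef, hφ, flux, Finset.smul_sum]
      refine Finset.sum_congr rfl fun i _ => ?_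
      rw [outwardNormal_eq hd hD hx.1, smul_smul]
      congr 1
      rw [PiLp.smul_apply, smul_eq_mul, mul_inv_cancel_left₀ hgn,
        hd.differentiableAt.hasGradientAt.hasFDerivAt.fderiv, InnerProductSpace.toDual_apply_apply,
        EuclideanSpace.inner_single_right]
      simp
    simp only [e, smul_smul, ha, div_eq_inv_mul]
  have hGT : ∀ x ∈ T, G x ∈ frontier D ∩ B := by
    intro x hx
    rw [← hS]
    refine ⟨Φ.map_target hx, ?_⟩
    change inner ℝ (b 0) (Φ (Φ.symm (hyperplaneMap b x))) = 0
    rw [Φ.right_inv hx, inner_hyperplaneMap]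
  have hac : ContinuousOn a (frontier D ∩ B) := by
    refine ContinuousOn.div ?_ (hdetc.mono inter_subset_right).abs
      fun x hx => abs_ne_zero.2 (hdet x hx.2).1
    exact ((continuousOn_gradient Metric.isOpen_ball hρB).mono inter_subset_right).norm
  have hacM : M ≪ μ := (Measure.absolutelyContinuous_of_le hm1).trans
    Measure.smul_absolutelyContinuous
  have haφm : AEStronglyMeasurable (fun x => a x • φ x) M :=
    ((hac.smul hφc).aestronglyMeasurable hSm).mono_ac hacM
  have hvol' : ∫ x in D, ∑ i, F' i x (EuclideanSpace.single i 1) = ∫ x, a x • φ x ∂M := by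
    rw [hDB, hvol, hM, integral_map hGm haφm]
    exact setIntegral_congr_fun hTm fun x hx => hNφ _ (hGT x hx)
  have hφM : Integrable φ M := hφi.smul_measure_nnreal.mono_measure hm1
  have haeM : ∀ᵐ x ∂M, x ∈ frontier D ∩ B := hacM.ae_le (ae_restrict_mem hSm)
  have ha1 : ∀ᵐ x ∂M, ‖a x • φ x - φ x‖ ≤ ε * ‖φ x‖ := by
    filter_upwards [haeM] with x hx
    have e : a x • φ x - φ x = (a x - 1) • φ x := by rw [sub_smul, one_smul]
    rw [e, norm_smul, Real.norm_eq_abs]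
    gcongr
    exact (hdet x hx.2).2
  have haφi : Integrable (fun x => a x • φ x - φ x) M :=
    (hφM.norm.const_mul (ε : ℝ)).mono' (haφm.sub hφM.aestronglyMeasurable) ha1
  have haφ : ∫ x, a x • φ x ∂M = ∫ x, (a x • φ x - φ x) ∂M + ∫ x, φ x ∂M := by
    rw [← integral_add haφi hφM]
    simp
  have hcL : (1 : ℝ≥0) ≤ L ^ m := one_le_pow₀ (by exact_mod_cast hL1)
  have hmain := norm_integral_sub_integral_le_of_le_smul hcL hm1 hm2 hφi
  have hM1 : ∫ x, ‖φ x‖ ∂M ≤ (L : ℝ) ^ m * ∫ x, ‖φ x‖ ∂μ := by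
    have := integral_mono_measure hm1 (Eventually.of_forall fun x => norm_nonneg (φ x))
      hφi.norm.smul_measure_nnreal
    rw [integral_smul_nnreal_measure, NNReal.smul_def, smul_eq_mul] at this
    exact_mod_cast this
  have hsmall : ‖∫ x, (a x • φ x - φ x) ∂M‖ ≤ ε * ∫ x, ‖φ x‖ ∂M := by
    rw [← integral_const_mul]
    exact norm_integral_le_of_norm_le (hφM.norm.const_mul _) ha1
  rw [setIntegral_eq_setIntegral_inter Metric.isOpen_ball.measurableSet hKB hφ0,
    setIntegral_eq_setIntegral_inter Metric.isOpen_ball.measurableSet hKB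
      (ψ := fun x => ‖φ x‖) (fun x hx => by rw [hφ0 x hx, norm_zero]), hvol', haφ,
    add_sub_assoc]
  -- One error comes from `|a - 1| ≤ ε`, the other from replacing `M` by the surface measure.
  refine (norm_add_le _ _).trans ((add_le_add hsmall hmain).trans ?_)
  rw [← hLr] at hεη
  push_cast
  have hI : 0 ≤ ∫ x, ‖φ x‖ ∂μ := integral_nonneg fun _ => norm_nonneg _
  calc _ ≤ ε * ((L : ℝ) ^ m * ∫ x, ‖φ x‖ ∂μ) + 3 * ((L : ℝ) ^ m - 1) * ∫ x, ‖φ x‖ ∂μ := by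
        gcongr
    _ = (ε * (L : ℝ) ^ m + 3 * ((L : ℝ) ^ m - 1)) * ∫ x, ‖φ x‖ ∂μ := by ring
    _ ≤ _ := by gcongr

end Divergence

/-! ### From local estimates to the global divergence theorem -/

section Global

open scoped Manifold

variable {p : ℕ} {D Ω : Set (V p)}

theorem isCompact_frontier (hb : Bornology.IsBounded D) : IsCompact (frontier D) :=
  hb.isCompact_closure.of_isClosed_subset isClosed_frontier frontier_subset_closure

/-- Compactness of the boundary reduces this to the finiteness near each point; the target `ℝ` and
the tolerance 1 play no role. -/
theorem measure_frontier_lt_top (hp : 1 ≤ p) (hD : IsOpen D) (hb : Bornology.IsBounded D)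
    (hs : HasSmoothBoundary D) : μHE[4 * p - 1] (frontier D) < ⊤ := by
  refine (isCompact_frontier hb).measure_lt_top_of_nhdsWithin fun x hx => ?_
  obtain ⟨r, hr, hfin, -⟩ := exists_ball_divergence_estimate hp hD hs ℝ hx one_pos
  exact ⟨_, inter_mem_nhdsWithin _ (Metric.ball_mem_nhds x hr), hfin⟩

theorem integrableOn_frontier (hp : 1 ≤ p) (hD : IsOpen D) (hb : Bornology.IsBounded D)
    (hs : HasSmoothBoundary D) {W : Type*} [NormedAddCommGroup W] {φ : V p → W}
    (hφ : ContinuousOn φ (frontier D)) :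
    IntegrableOn φ (frontier D) μHE[4 * p - 1] := by
  obtain ⟨C, hC⟩ := (isCompact_frontier hb).exists_bound_of_continuousOn hφ
  have : IsFiniteMeasure ((μHE[4 * p - 1] : Measure (V p)).restrict (frontier D)) :=
    ⟨by simpa using measure_frontier_lt_top hp hD hb hs⟩
  refine Integrable.of_bound (hφ.aestronglyMeasurable isClosed_frontier.measurableSet) C ?_
  exact (ae_restrict_iff' isClosed_frontier.measurableSet).2 (Eventually.of_forall hC)

/-- A finite smooth partition of unity on the closure of a bounded set. -/
theorem exists_finite_partition (hb : Bornology.IsBounded D) {r : V p → ℝ}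
    (hr : ∀ x ∈ closure D, 0 < r x) :
    ∃ (t : Finset (V p)) (χ : t → V p → ℝ), (∀ i : t, (i : V p) ∈ closure D) ∧
      (∀ i, ContDiff ℝ ∞ (χ i)) ∧ (∀ i x, 0 ≤ χ i x) ∧
      (∀ i : t, tsupport (χ i) ⊆ Metric.ball (i : V p) (r i)) ∧
      ∀ x ∈ closure D, ∑ i, χ i x = 1 := by
  obtain ⟨t, htD, ht⟩ := hb.isCompact_closure.elim_nhds_subcover (fun x => Metric.ball x (r x))
    fun x hx => Metric.ball_mem_nhds x (hr x hx)
  obtain ⟨f, hf⟩ := SmoothPartitionOfUnity.exists_isSubordinate 𝓘(ℝ, V p) isClosed_closure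
    (fun i : t => Metric.ball (i : V p) (r i)) (fun i => Metric.isOpen_ball)
    (fun x hx => by
      obtain ⟨i, hi, hxi⟩ := mem_iUnion₂.1 (ht hx)
      exact mem_iUnion.2 ⟨⟨i, hi⟩, hxi⟩)
  refine ⟨t, fun i => f i, fun i => htD i i.2, fun i => (f i).contMDiff.contDiff,
    fun i x => f.nonneg i x, hf, fun x hx => ?_⟩
  rw [← finsum_eq_sum_of_fintype]
  exact f.sum_eq_one hx

/-- For an interior point the ball is taken inside `D`, and both integrals vanish for a field
supported there. For a boundary point it is the estimate already obtained. -/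
theorem exists_radius_divergence_estimate (hp : 1 ≤ p) (hD : IsOpen D) (hs : HasSmoothBoundary D)
    (W : Type*) [NormedAddCommGroup W] [NormedSpace ℝ W] [CompleteSpace W] (hΩ : IsOpen Ω)
    (hDΩ : closure D ⊆ Ω) {η : ℝ} (hη : 0 < η) {x : V p} (hx : x ∈ closure D) :
    ∃ r > 0, Metric.ball x r ⊆ Ω ∧
      ∀ (F : Fin (4 * p) → V p → W) (F' : Fin (4 * p) → V p → V p →L[ℝ] W) (K : Set (V p)),
        (∀ i x, HasFDerivAt (F i) (F' i x) x) → IsCompact K → K ⊆ Metric.ball x r →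
        (∀ i, ∀ x ∉ K, F i x = 0) →
        (Continuous fun x => ∑ i, F' i x (EuclideanSpace.single i 1)) →
        ‖(∫ x in D, ∑ i, F' i x (EuclideanSpace.single i 1)) -
            ∫ x in frontier D, flux D F x ∂μHE[4 * p - 1]‖ ≤
          η * ∫ x in frontier D, ‖flux D F x‖ ∂μHE[4 * p - 1] := by
  obtain ⟨r₁, hr₁, hΩ₁⟩ := Metric.isOpen_iff.1 hΩ x (hDΩ hx)
  by_cases hxD : x ∈ D
  · obtain ⟨r₂, hr₂, hD₂⟩ := Metric.isOpen_iff.1 hD x hxD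
    refine ⟨min r₁ r₂, lt_min hr₁ hr₂,
      (Metric.ball_subset_ball (min_le_left _ _)).trans hΩ₁, ?_⟩
    intro F F' K hF hK hKB hF0 hdiv
    have hKD : K ⊆ D := hKB.trans ((Metric.ball_subset_ball (min_le_right _ _)).trans hD₂)
    have hdv0 : ∀ x ∉ K, ∑ i, F' i x (EuclideanSpace.single i 1) = 0 := fun x hx => by
      simp [fderiv_eq_zero_of_notMem hF hK hF0 _ hx]
    have h1 : ∫ x in D, ∑ i, F' i x (EuclideanSpace.single i 1) = 0 := by
      rw [setIntegral_eq_integral_of_forall_compl_eq_zero fun x hx => hdv0 x fun h => hx (hKD h)]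
      exact integral_divergence_eq_zero hF (fun i => HasCompactSupport.intro hK (hF0 i))
        (hdiv.integrable_of_hasCompactSupport (HasCompactSupport.intro hK hdv0))
    have h2 : ∫ x in frontier D, flux D F x ∂μHE[4 * p - 1] = 0 := by
      refine setIntegral_eq_zero_of_forall_eq_zero fun x hx => ?_
      have : x ∉ K := fun h => by
        rw [hD.frontier_eq] at hx
        exact hx.2 (hKD h)
      simp [flux, hF0 _ x this]
    rw [h1, h2, sub_zero, norm_zero]
    exact mul_nonneg hη.le (integral_nonneg fun _ => norm_nonneg _)
  · have hxf : x ∈ frontier D := by rw [hD.frontier_eq]; exact ⟨hx, hxD⟩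
    obtain ⟨r₂, hr₂, -, hest⟩ := exists_ball_divergence_estimate hp hD hs W hxf hη
    refine ⟨min r₁ r₂, lt_min hr₁ hr₂,
      (Metric.ball_subset_ball (min_le_left _ _)).trans hΩ₁, ?_⟩
    intro F F' K hF hK hKB hF0 hdiv
    exact hest F F' K hF hK (hKB.trans (Metric.ball_subset_ball (min_le_right _ _))) hF0 hdiv

/-- **Divergence theorem** on a bounded smooth domain, for vector fields which are differentiable
near the closed domain and have a continuous divergence. -/
theorem integral_divergence_eq_integral_flux (hp : 1 ≤ p) (hD : IsOpen D)
    (hb : Bornology.IsBounded D) (hs : HasSmoothBoundary D) (hΩ : IsOpen Ω) (hDΩ : closure D ⊆ Ω)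
    {W : Type*} [NormedAddCommGroup W] [NormedSpace ℝ W] [CompleteSpace W]
    {F : Fin (4 * p) → V p → W} {F' : Fin (4 * p) → V p → V p →L[ℝ] W}
    (hF : ∀ i, ∀ x ∈ Ω, HasFDerivAt (F i) (F' i x) x)
    (hdiv : ContinuousOn (fun x => ∑ i, F' i x (EuclideanSpace.single i 1)) Ω) :
    ∫ x in D, ∑ i, F' i x (EuclideanSpace.single i 1) =
      ∫ x in frontier D, flux D F x ∂μHE[4 * p - 1] := by
  have hFc : ∀ i, ContinuousOn (F i) Ω := fun i x hx =>
    (hF i x hx).continuousAt.continuousWithinAt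
  have hfΩ : frontier D ⊆ Ω := frontier_subset_closure.trans hDΩ
  set dv := fun x => ∑ i, F' i x (EuclideanSpace.single i 1) with hdv
  -- The factor of `η` does not depend on `η`, so the estimate forces equality as `η → 0`.
  suffices h : ∀ η : ℝ, 0 < η → ‖(∫ x in D, dv x) - ∫ x in frontier D, flux D F x ∂μHE[4 * p - 1]‖ ≤
      η * ∫ x in frontier D, ‖flux D F x‖ ∂μHE[4 * p - 1] by
    rw [← sub_eq_zero, ← norm_le_zero_iff]
    set I := ∫ x in frontier D, ‖flux D F x‖ ∂μHE[4 * p - 1]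
    have h1 : Tendsto (fun η : ℝ => η * I) (𝓝[>] 0) (𝓝 0) := by
      have : Continuous fun η : ℝ => η * I := by fun_prop
      simpa using (this.tendsto 0).mono_left nhdsWithin_le_nhds
    exact ge_of_tendsto h1 (eventually_nhdsWithin_of_forall h)
  intro η hη
  choose! r hr0 hrΩ hest using fun x (hx : x ∈ closure D) =>
    exists_radius_divergence_estimate hp hD hs W hΩ hDΩ hη hx
  obtain ⟨t, χ, htD, hχ, hχ0, hsupp, hsum⟩ := exists_finite_partition hb hr0
  have hKc : ∀ i, IsCompact (tsupport (χ i)) := fun i =>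
    Metric.isCompact_of_isClosed_isBounded (isClosed_tsupport _)
      (Metric.isBounded_ball.subset (hsupp i))
  have hKΩ : ∀ i, tsupport (χ i) ⊆ Ω := fun i => (hsupp i).trans (hrΩ i (htD i))
  set G : t → Fin (4 * p) → V p → W := fun i α x => χ i x • F α x with hG
  set G' : t → Fin (4 * p) → V p → V p →L[ℝ] W := fun i α x =>
    χ i x • F' α x + (fderiv ℝ (χ i) x).smulRight (F α x) with hG'
  have hχd : ∀ i x, HasFDerivAt (χ i) (fderiv ℝ (χ i) x) x := fun i x =>
    ((hχ i).differentiable (by simp) x).hasFDerivAt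
  have hχz : ∀ i, ∀ x ∉ tsupport (χ i), χ i x = 0 := fun i x => image_eq_zero_of_notMem_tsupport
  have hχ'z : ∀ i, ∀ x ∉ tsupport (χ i), fderiv ℝ (χ i) x = 0 := fun i x hx =>
    image_eq_zero_of_notMem_tsupport fun h => hx (tsupport_fderiv_subset ℝ h)
  have hGd : ∀ i α x, HasFDerivAt (G i α) (G' i α x) x := by
    intro i α x
    by_cases hx : x ∈ tsupport (χ i)
    · exact (hχd i x).smul (hF α x (hKΩ i hx))
    · have h1 : G i α =ᶠ[𝓝 x] fun _ => 0 := by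
        filter_upwards [(isClosed_tsupport (χ i)).isOpen_compl.mem_nhds hx] with y hy
        simp [hG, hχz i y hy]
      have h2 : G' i α x = 0 := by
        ext w
        simp [hG', hχz i x hx, hχ'z i x hx]
      rw [h2]
      exact (hasFDerivAt_const (0 : W) x).congr_of_eventuallyEq h1
  have hGdiv : ∀ i x, ∑ α, G' i α x (EuclideanSpace.single α 1) =
      χ i x • dv x + ∑ α, fderiv ℝ (χ i) x (EuclideanSpace.single α 1) • F α x := by
    intro i x
    simp [hG', hdv, Finset.sum_add_distrib, Finset.smul_sum]
  have hGc : ∀ i, Continuous fun x => ∑ α, G' i α x (EuclideanSpace.single α 1) := by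
    intro i
    refine continuous_of_continuousOn_of_eq_zero hΩ (hKc i) (hKΩ i) ?_ fun x hx => ?_
    · simp only [hGdiv]
      refine ((hχ i).continuous.continuousOn.smul hdiv).add
        (continuousOn_finsetSum _ fun α _ => ContinuousOn.smul ?_ (hFc α))
      exact (((hχ i).continuous_fderiv (by simp)).clm_apply continuous_const).continuousOn
    · rw [hGdiv]
      simp [hχz i x hx, hχ'z i x hx]
  have hGi : ∀ i, Integrable fun x => ∑ α, G' i α x (EuclideanSpace.single α 1) := fun i =>
    (hGc i).integrable_of_hasCompactSupport (HasCompactSupport.intro (hKc i) fun x hx => by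
      rw [hGdiv]; simp [hχz i x hx, hχ'z i x hx])
  have hflux : ∀ i x, flux D (G i) x = χ i x • flux D F x := by
    intro i x
    simp only [flux, hG, Finset.smul_sum]
    exact Finset.sum_congr rfl fun α _ => smul_comm _ _ _
  have hfc : ContinuousOn (flux D F) (frontier D) :=
    continuousOn_flux hD hs fun α => (hFc α).mono hfΩ
  have hfi : ∀ i, IntegrableOn (flux D (G i)) (frontier D) μHE[4 * p - 1] := by
    intro i
    refine integrableOn_frontier hp hD hb hs ?_
    exact ((hχ i).continuous.continuousOn.smul hfc).congr fun x _ => hflux i x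
  have hvol : ∫ x in D, dv x = ∑ i, ∫ x in D, ∑ α, G' i α x (EuclideanSpace.single α 1) := by
    rw [← integral_finsetSum _ fun i _ => (hGi i).integrableOn]
    refine setIntegral_congr_fun hD.measurableSet fun x hx => ?_
    -- The sum of the `χ i` is 1 on the open set `D`, hence near `x`, so the gradient terms of the
    -- product rule cancel.
    have h0 : ∑ i, fderiv ℝ (χ i) x = 0 := by
      have h1 : HasFDerivAt (fun y => ∑ i, χ i y) (∑ i, fderiv ℝ (χ i) x) x :=
        HasFDerivAt.fun_sum fun i _ => hχd i x
      have h2 : (fun y => ∑ i, χ i y) =ᶠ[𝓝 x] fun _ => 1 := by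
        filter_upwards [hD.mem_nhds hx] with y hy
        exact hsum y (subset_closure hy)
      exact (h1.congr_of_eventuallyEq h2.symm).unique (hasFDerivAt_const 1 x)
    simp only [hGdiv]
    rw [Finset.sum_add_distrib, ← Finset.sum_smul, hsum x (subset_closure hx), one_smul,
      Finset.sum_comm]
    have h3 : ∀ α, ∑ i, fderiv ℝ (χ i) x (EuclideanSpace.single α 1) • F α x = 0 := by
      intro α
      rw [← Finset.sum_smul, ← _root_.sum_apply, h0]
      simp
    rw [Finset.sum_eq_zero fun α _ => h3 α, add_zero]
  have hbdy : ∫ x in frontier D, flux D F x ∂μHE[4 * p - 1] =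
      ∑ i, ∫ x in frontier D, flux D (G i) x ∂μHE[4 * p - 1] := by
    rw [← integral_finsetSum _ fun i _ => hfi i]
    refine setIntegral_congr_fun isClosed_frontier.measurableSet fun x hx => ?_
    simp only [hflux]
    rw [← Finset.sum_smul, hsum x (frontier_subset_closure hx), one_smul]
  -- As the `χ i` are nonnegative, the absolute fluxes also add up exactly. The total error
  -- therefore does not grow with the number of pieces.
  have hnorm : ∫ x in frontier D, ‖flux D F x‖ ∂μHE[4 * p - 1] =
      ∑ i, ∫ x in frontier D, ‖flux D (G i) x‖ ∂μHE[4 * p - 1] := by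
    rw [← integral_finsetSum _ fun i _ => (hfi i).norm]
    refine setIntegral_congr_fun isClosed_frontier.measurableSet fun x hx => ?_
    simp only [hflux, norm_smul, Real.norm_of_nonneg (hχ0 _ x)]
    rw [← Finset.sum_mul, hsum x (frontier_subset_closure hx), one_mul]
  rw [hvol, hbdy, hnorm, ← Finset.sum_sub_distrib, Finset.mul_sum]
  refine (norm_sum_le _ _).trans (Finset.sum_le_sum fun i _ => ?_)
  exact hest i (htD i) (G i) (G' i) (tsupport (χ i)) (hGd i) (hKc i) (hsupp i)
    (fun α x hx => by simp [hG, hχz i x hx]) (hGc i)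

end Global

/-! ### A reproducing formula for systems of Dirac type -/

section Cauchy

variable {p : ℕ}

theorem pow_four_mul (s : ℝ) (p : ℕ) : s ^ (4 * p) = (s ^ 2) ^ (2 * p) := by
  rw [← pow_mul]
  congr 1
  ring

/-- The unnormalized profile `4p (1 + |v|²)^{-2p-1}` of an approximate identity. -/
def peak (v : V p) : ℝ := 4 * p * ((1 + ‖v‖ ^ 2) ^ (2 * p + 1))⁻¹

/-- The total mass of `peak`. -/
def peakMass (p : ℕ) : ℝ := ∫ v : V p, peak v

theorem peak_nonneg (v : V p) : 0 ≤ peak v := by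
  unfold peak
  positivity

theorem integrable_peak : Integrable (peak : V p → ℝ) := by
  -- The decay exponent `4p + 2` exceeds the dimension `4p`.
  have h := integrable_rpow_neg_one_add_norm_sq (E := V p) (μ := volume) (r := 4 * p + 2)
    (by simp)
  refine (h.const_mul (4 * p : ℝ)).congr (Eventually.of_forall fun v => ?_)
  have h0 : (0 : ℝ) ≤ 1 + ‖v‖ ^ 2 := by positivity
  simp only [peak]
  rw [show (-(4 * p + 2 : ℝ) / 2) = -((2 * p + 1 : ℕ) : ℝ) by push_cast; ring,
    Real.rpow_neg h0, Real.rpow_natCast]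

theorem peakMass_pos (hp : 1 ≤ p) : 0 < peakMass p := by
  refine (integral_pos_iff_support_of_nonneg peak_nonneg integrable_peak).2 ?_
  have h : Function.support (peak : V p → ℝ) = univ := by
    ext v
    have h1 : (0 : ℝ) < p := by exact_mod_cast hp
    have h2 : 0 < peak v := by unfold peak; positivity
    simpa using h2.ne'
  rw [h]
  exact isOpen_univ.measure_pos volume univ_nonempty

/-- This is the decay condition under which the rescaled profiles concentrate at a point for every
integrable function continuous there. -/
theorem tendsto_norm_pow_mul_peak :
    Tendsto (fun v : V p => ‖v‖ ^ (4 * p) * peak v) (Bornology.cobounded (V p)) (𝓝 0) := by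
  have h1 : Tendsto (fun v : V p => (4 * p : ℝ) * (1 + ‖v‖ ^ 2)⁻¹) (Bornology.cobounded (V p))
      (𝓝 0) := by
    have h2 : Tendsto (fun v : V p => 1 + ‖v‖ ^ 2) (Bornology.cobounded (V p)) atTop :=
      tendsto_atTop_add_const_left _ _
        ((tendsto_pow_atTop two_ne_zero).comp tendsto_norm_cobounded_atTop)
    simpa using h2.inv_tendsto_atTop.const_mul (4 * p : ℝ)
  refine squeeze_zero (fun v => mul_nonneg (by positivity) (peak_nonneg v)) (fun v => ?_) h1
  have h3 : ‖v‖ ^ (4 * p) ≤ (1 + ‖v‖ ^ 2) ^ (2 * p) := by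
    rw [pow_four_mul]
    gcongr
    linarith
  have h4 : (0 : ℝ) < 1 + ‖v‖ ^ 2 := by positivity
  calc ‖v‖ ^ (4 * p) * peak v ≤ (1 + ‖v‖ ^ 2) ^ (2 * p) * peak v := by
        gcongr
        exact peak_nonneg v
    _ = 4 * p * (1 + ‖v‖ ^ 2)⁻¹ := by
        unfold peak
        field_simp
        ring

variable {W : Type*} [NormedAddCommGroup W] [NormedSpace ℝ W]

/-- After division by its mass, `peak` generates an approximate identity; being even, it allows `X -
Y` and `Y - X` to be exchanged. -/
theorem tendsto_integral_peak [CompleteSpace W] (hp : 1 ≤ p) {g : V p → W} {X : V p}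
    (hg : Integrable g) (hgX : ContinuousAt g X) :
    Tendsto (fun t : ℝ => ∫ Y, (t ^ (4 * p) * peak (t • (Y - X))) • g Y) atTop
      (𝓝 (peakMass p • g X)) := by
  have hm := peakMass_pos hp
  have h := tendsto_integral_comp_smul_smul_of_integrable' (μ := (volume : Measure (V p)))
    (φ := fun v => (peakMass p)⁻¹ * peak v) (g := g) (x₀ := X)
    (fun v => mul_nonneg (inv_pos.2 hm).le (peak_nonneg v))
    (by rw [integral_const_mul]; exact inv_mul_cancel₀ hm.ne')
    (by
      have := (tendsto_norm_pow_mul_peak (p := p)).const_mul (peakMass p)⁻¹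
      rw [mul_zero] at this
      refine this.congr fun v => ?_
      simp only [finrank_euclideanSpace, Fintype.card_fin]
      ring) hg hgX
  have h' := h.const_smul (peakMass p)
  refine h'.congr fun t => ?_
  rw [← integral_smul]
  refine integral_congr_ae (Eventually.of_forall fun Y => ?_)
  have e : peak (t • (X - Y)) = peak (t • (Y - X)) := by
    simp only [peak, norm_smul, norm_sub_rev X Y]
  simp only [smul_smul, e, finrank_euclideanSpace, Fintype.card_fin]
  congr 1
  field_simp

/-- The derivative of the regularized kernel `(|v|² + ε)^{-2p}`. -/
theorem hasFDerivAt_regularized {ε : ℝ} (hε : 0 < ε) (X Y : V p) :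
    HasFDerivAt (fun Y => ((‖Y - X‖ ^ 2 + ε) ^ (2 * p))⁻¹)
      ((-(4 * p * ((‖Y - X‖ ^ 2 + ε) ^ (2 * p + 1))⁻¹)) • innerSL ℝ (Y - X)) Y := by
  have hpos : 0 < ‖Y - X‖ ^ 2 + ε := by positivity
  have h1 : HasFDerivAt (fun Y => ‖Y - X‖ ^ 2 + ε) ((2 : ℝ) • innerSL ℝ (Y - X)) Y := by
    have h := (((hasFDerivAt_id Y).sub_const X).norm_sq).add_const ε
    refine h.congr_fderiv ?_
    ext w
    simp
  have h2 : HasDerivAt (fun s : ℝ => (s ^ (2 * p))⁻¹)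
      (-(2 * p * ((‖Y - X‖ ^ 2 + ε) ^ (2 * p + 1))⁻¹)) (‖Y - X‖ ^ 2 + ε) := by
    have h := (hasDerivAt_pow (2 * p) (‖Y - X‖ ^ 2 + ε)).inv (pow_ne_zero _ hpos.ne')
    refine h.congr_deriv ?_
    rcases p with _ | p
    · simp
    · rw [show 2 * (p + 1) - 1 = 2 * p + 1 by omega]
      push_cast
      field_simp
      ring
  have h3 := h2.comp_hasFDerivAt Y h1
  refine h3.congr_fderiv ?_
  rw [smul_smul]
  congr 1
  ring

variable {D Ω : Set (V p)} {P : Fin (4 * p) → V p →L[ℝ] W →L[ℝ] W} {c : ℝ} {g : V p → W} {X : V p}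

/-- The flux of the regularized kernel through the boundary. -/
theorem integral_flux_regularized [CompleteSpace W] (hp : 1 ≤ p) (hD : IsOpen D)
    (hb : Bornology.IsBounded D) (hs : HasSmoothBoundary D) (hΩ : IsOpen Ω) (hDΩ : closure D ⊆ Ω)
    (hP : ∀ v w, ∑ α, v α • P α v w = (c * ‖v‖ ^ 2) • w) (hg : DifferentiableOn ℝ g Ω)
    (hg0 : ∀ Y ∈ Ω, ∀ v, ∑ α, P α v (fderiv ℝ g Y (EuclideanSpace.single α 1)) = 0)
    {ε : ℝ} (hε : 0 < ε) :
    ∫ Y in frontier D, flux D (fun α Y => ((‖Y - X‖ ^ 2 + ε) ^ (2 * p))⁻¹ • P α (Y - X) (g Y)) Y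
        ∂μHE[4 * p - 1] =
      ∫ Y in D, (c * (4 * p * ε * ((‖Y - X‖ ^ 2 + ε) ^ (2 * p + 1))⁻¹)) • g Y := by
  set F' : Fin (4 * p) → V p → V p →L[ℝ] W := fun α Y =>
    ((‖Y - X‖ ^ 2 + ε) ^ (2 * p))⁻¹ • (P α (Y - X) ∘L fderiv ℝ g Y + (P α).flip (g Y)) +
      ((-(4 * p * ((‖Y - X‖ ^ 2 + ε) ^ (2 * p + 1))⁻¹)) • innerSL ℝ (Y - X)).smulRight
        (P α (Y - X) (g Y)) with hF'
  have hF : ∀ α, ∀ Y ∈ Ω, HasFDerivAt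
      (fun Y => ((‖Y - X‖ ^ 2 + ε) ^ (2 * p))⁻¹ • P α (Y - X) (g Y)) (F' α Y) Y := by
    intro α Y hY
    have h1 : HasFDerivAt g (fderiv ℝ g Y) Y :=
      ((hg Y hY).differentiableAt (hΩ.mem_nhds hY)).hasFDerivAt
    have h2 : HasFDerivAt (fun Y => P α (Y - X)) (P α) Y := by
      exact (P α).hasFDerivAt.comp Y ((hasFDerivAt_id Y).sub_const X)
    have h3 := h2.clm_apply h1
    exact (hasFDerivAt_regularized hε X Y).smul h3
  have hdiv : ∀ Y ∈ Ω, ∑ α, F' α Y (EuclideanSpace.single α 1) =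
      (c * (4 * p * ε * ((‖Y - X‖ ^ 2 + ε) ^ (2 * p + 1))⁻¹)) • g Y := by
    intro Y hY
    have hpos : 0 < ‖Y - X‖ ^ 2 + ε := by positivity
    -- The case `v = ε_α` of the quadratic identity `hP`; summed over `α` it contributes the factor
    -- `4p`.
    have e1 : ∀ α, P α (EuclideanSpace.single α 1) (g Y) = c • g Y := by
      intro α
      have h := hP (EuclideanSpace.single α 1) (g Y)
      rw [Finset.sum_eq_single α] at h
      · simpa using h
      · intro β _ hβ
        simp [hβ]
      · simp
    have e2 : ∀ α, F' α Y (EuclideanSpace.single α 1) =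
        ((‖Y - X‖ ^ 2 + ε) ^ (2 * p))⁻¹ • P α (Y - X) (fderiv ℝ g Y (EuclideanSpace.single α 1)) +
        ((‖Y - X‖ ^ 2 + ε) ^ (2 * p))⁻¹ • (c • g Y) +
        (-(4 * p * ((‖Y - X‖ ^ 2 + ε) ^ (2 * p + 1))⁻¹)) •
          ((Y - X) α • P α (Y - X) (g Y)) := by
      intro α
      have e3 : inner ℝ (Y - X) (EuclideanSpace.single α (1 : ℝ)) = (Y - X) α := by
        rw [EuclideanSpace.inner_single_right]
        simp
      simp only [hF', add_apply, smul_apply, ContinuousLinearMap.comp_apply,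
        ContinuousLinearMap.flip_apply, ContinuousLinearMap.smulRight_apply, innerSL_apply_apply,
        e1, e3, smul_add, smul_smul, smul_eq_mul]
    simp only [e2]
    rw [Finset.sum_add_distrib, Finset.sum_add_distrib, ← Finset.smul_sum, hg0 Y hY,
      ← Finset.smul_sum (f := fun α => (Y - X) α • P α (Y - X) (g Y)), hP, smul_zero, zero_add,
      Finset.sum_const, Finset.card_univ,
      Fintype.card_fin, ← Nat.cast_smul_eq_nsmul ℝ, smul_smul, smul_smul, smul_smul, ← add_smul]
    -- With `s = |v|² + ε` the scalars are `4pc s^{-2p} - 4pc |v|² s^{-2p-1} = 4pcε s^{-2p-1}`.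
    congr 1
    rw [pow_succ]
    push_cast
    field_simp
    ring
  -- The derivatives of `g` have dropped out of the divergence, which is thus continuous although
  -- those of `g` need not be.
  have hcont : ContinuousOn (fun Y => ∑ α, F' α Y (EuclideanSpace.single α 1)) Ω := by
    refine ContinuousOn.congr ?_ hdiv
    refine ContinuousOn.smul ?_ hg.continuousOn
    refine Continuous.continuousOn (continuous_const.mul (continuous_const.mul
      (Continuous.inv₀ (by fun_prop) fun Y => ?_)))
    positivity
  rw [← integral_divergence_eq_integral_flux hp hD hb hs hΩ hDΩ hF hcont]
  exact setIntegral_congr_fun hD.measurableSet fun Y hY => hdiv Y (hDΩ (subset_closure hY))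

theorem continuousOn_kernel_flux (hD : IsOpen D) (hs : HasSmoothBoundary D)
    (hg : ContinuousOn g (frontier D)) (hX : X ∈ D) :
    ContinuousOn (flux D fun α Y => (‖Y - X‖ ^ (4 * p))⁻¹ • P α (Y - X) (g Y)) (frontier D) := by
  refine continuousOn_flux hD hs fun α => ?_
  have hne : ∀ Y ∈ frontier D, ‖Y - X‖ ^ (4 * p) ≠ 0 := by
    intro Y hY
    rw [hD.frontier_eq] at hY
    refine pow_ne_zero _ (norm_ne_zero_iff.2 (sub_ne_zero.2 ?_))
    rintro rfl
    exact hY.2 hX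
  refine ContinuousOn.smul (ContinuousOn.inv₀ (by fun_prop) hne) ?_
  exact ((P α).continuous.comp_continuousOn (by fun_prop)).clm_apply hg

/-- The boundary integral of the kernel reproduces solutions of the system. -/
theorem integral_kernel_flux [CompleteSpace W] (hp : 1 ≤ p) (hD : IsOpen D)
    (hb : Bornology.IsBounded D) (hs : HasSmoothBoundary D) (hΩ : IsOpen Ω) (hDΩ : closure D ⊆ Ω)
    (hP : ∀ v w, ∑ α, v α • P α v w = (c * ‖v‖ ^ 2) • w) (hg : DifferentiableOn ℝ g Ω)
    (hg0 : ∀ Y ∈ Ω, ∀ v, ∑ α, P α v (fderiv ℝ g Y (EuclideanSpace.single α 1)) = 0)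
    (hX : X ∈ D) :
    ∫ Y in frontier D, flux D (fun α Y => (‖Y - X‖ ^ (4 * p))⁻¹ • P α (Y - X) (g Y)) Y
        ∂μHE[4 * p - 1] = (c * peakMass p) • g X := by
  have hgc : ContinuousOn g Ω := hg.continuousOn
  have hfr : frontier D ⊆ Ω := frontier_subset_closure.trans hDΩ
  have hgi : Integrable (D.indicator g) := by
    -- Extension by zero makes `g` integrable on the whole space without changing it near `X`.
    rw [integrable_indicator_iff hD.measurableSet]
    exact ((hgc.mono hDΩ).integrableOn_compact hb.isCompact_closure).mono_set subset_closure
  have hgX : ContinuousAt (D.indicator g) X := by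
    refine (hgc.continuousAt (hΩ.mem_nhds (hDΩ (subset_closure hX)))).congr ?_
    filter_upwards [hD.mem_nhds hX] with Y hY
    rw [indicator_of_mem hY]
  have hR := (tendsto_integral_peak hp hgi hgX).const_smul c
  rw [indicator_of_mem hX, smul_smul] at hR
  -- With `ε = t^{-2}` the divergence becomes `c t^{4p} peak (t v) g`. The limit `t → ∞` is taken on
  -- the boundary by dominated convergence and in the volume by the approximate identity.
  refine tendsto_nhds_unique (f := fun t : ℝ => ∫ Y in frontier D, flux D (fun α Y =>
    ((‖Y - X‖ ^ 2 + (t ^ 2)⁻¹) ^ (2 * p))⁻¹ • P α (Y - X) (g Y)) Y ∂μHE[4 * p - 1])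
    (l := atTop) ?_ (hR.congr' ?_)
  · have hne : ∀ Y ∈ frontier D, 0 < ‖Y - X‖ := by
      intro Y hY
      rw [hD.frontier_eq] at hY
      refine norm_pos_iff.2 (sub_ne_zero.2 ?_)
      rintro rfl
      exact hY.2 hX
    have hfl : ∀ (κ : V p → ℝ) Y, flux D (fun α Y => κ Y • P α (Y - X) (g Y)) Y =
        κ Y • flux D (fun α Y => P α (Y - X) (g Y)) Y := by
      intro κ Y
      simp only [flux, Finset.smul_sum]
      exact Finset.sum_congr rfl fun α _ => smul_comm _ _ _
    -- The limit kernel itself dominates, since `(|v|² + ε)^{-2p} ≤ |v|^{-4p}`, and `X` does not lie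
    -- on `∂D`.
    have hmain := integrableOn_frontier hp hD hb hs
      (continuousOn_kernel_flux (P := P) hD hs (hgc.mono hfr) hX)
    refine tendsto_integral_filter_of_dominated_convergence _ ?_ ?_ hmain.norm ?_
    · filter_upwards [eventually_gt_atTop 0] with t ht
      refine ContinuousOn.aestronglyMeasurable ?_ isClosed_frontier.measurableSet
      refine continuousOn_flux hD hs fun α => ?_
      refine ContinuousOn.smul (Continuous.continuousOn
        (Continuous.inv₀ (by fun_prop) fun Y => by positivity)) ?_
      exact ((P α).continuous.comp_continuousOn (by fun_prop)).clm_apply (hgc.mono hfr)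
    · filter_upwards [eventually_gt_atTop 0] with t ht
      refine (ae_restrict_iff' isClosed_frontier.measurableSet).2 (Eventually.of_forall ?_)
      intro Y hY
      have hY0 := hne Y hY
      rw [hfl (fun Y => ((‖Y - X‖ ^ 2 + (t ^ 2)⁻¹) ^ (2 * p))⁻¹),
        hfl (fun Y => (‖Y - X‖ ^ (4 * p))⁻¹), norm_smul, norm_smul]
      gcongr
      rw [Real.norm_of_nonneg (by positivity), Real.norm_of_nonneg (by positivity),
        pow_four_mul]
      gcongr
      have : 0 ≤ (t ^ 2)⁻¹ := by positivity
      linarith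
    · refine (ae_restrict_iff' isClosed_frontier.measurableSet).2 (Eventually.of_forall ?_)
      intro Y hY
      have hY0 := hne Y hY
      simp only [hfl (fun Y => (‖Y - X‖ ^ (4 * p))⁻¹),
        fun t : ℝ => hfl (fun Y => ((‖Y - X‖ ^ 2 + (t ^ 2)⁻¹) ^ (2 * p))⁻¹) Y]
      refine Tendsto.smul_const ?_ _
      have h1 : Tendsto (fun t : ℝ => (t ^ 2)⁻¹) atTop (𝓝 0) :=
        (tendsto_pow_atTop two_ne_zero).inv_tendsto_atTop
      have h2 := (((h1.const_add (‖Y - X‖ ^ 2)).pow (2 * p)).inv₀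
        (by rw [add_zero]; positivity))
      rw [add_zero, ← pow_four_mul] at h2
      exact h2
  · filter_upwards [eventually_gt_atTop 0] with t ht
    rw [integral_flux_regularized hp hD hb hs hΩ hDΩ hP hg hg0 (by positivity),
      ← integral_indicator hD.measurableSet, ← integral_smul]
    refine integral_congr_ae (Eventually.of_forall fun Y => ?_)
    by_cases hY : Y ∈ D
    · simp only [indicator_of_mem hY, smul_smul]
      congr 1
      simp only [peak, norm_smul, Real.norm_of_nonneg ht.le]
      have e : ‖Y - X‖ ^ 2 + (t ^ 2)⁻¹ = (t ^ 2)⁻¹ * (1 + (t * ‖Y - X‖) ^ 2) := by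
        field_simp
        ring
      have hpos : 0 < 1 + (t * ‖Y - X‖) ^ 2 := by positivity
      rw [e, mul_pow ((t ^ 2)⁻¹), inv_pow, mul_inv, inv_inv, pow_succ (t ^ 2), ← pow_four_mul]
      field_simp
    · simp [indicator_of_notMem hY]

end Cauchy

/-! ### The area of the unit sphere -/

theorem isLocalDefiningFunction_ball {p : ℕ} {x : V p} (hx : x ≠ 0) :
    IsLocalDefiningFunction (Metric.ball (0 : V p) 1) x {0}ᶜ (fun y => ‖y‖ ^ 2 - 1) ∧
      gradient (fun y : V p => ‖y‖ ^ 2 - 1) x = (2 : ℝ) • x := by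
  have hgr : ∀ y : V p, gradient (fun y : V p => ‖y‖ ^ 2 - 1) y = (2 : ℝ) • y := by
    intro y
    refine HasGradientAt.gradient ?_
    rw [hasGradientAt_iff_hasFDerivAt]
    have h := ((hasFDerivAt_id y).norm_sq).sub_const (1 : ℝ)
    refine h.congr_fderiv ?_
    ext w
    simp
  refine ⟨⟨isOpen_compl_singleton, hx, ?_, ?_, ?_⟩, hgr x⟩
  · exact ((contDiff_norm_sq ℝ).sub contDiff_const).contDiffOn
  · intro y hy
    rw [hgr]
    exact smul_ne_zero two_ne_zero hy
  · intro y _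
    rw [mem_ball_zero_iff, sub_neg, sq_lt_one_iff₀ (norm_nonneg y)]

/-- On the unit ball with `g = 1` and `P_α(v) w = v_α w`, the field `v / |v|^{4p}` has flux density
1 on the sphere, so the boundary integral is the area. -/
theorem area_eq_peakMass {p : ℕ} (hp : 1 ≤ p) : area p = peakMass p := by
  have hne : ∀ x ∈ frontier (Metric.ball (0 : V p) 1), x ≠ 0 ∧ ‖x‖ = 1 := by
    intro x hx
    rw [frontier_ball _ one_ne_zero, mem_sphere_zero_iff_norm] at hx
    exact ⟨fun h => by simp [h] at hx, hx⟩
  have hs : HasSmoothBoundary (Metric.ball (0 : V p) 1) := fun x hx =>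
    ⟨_, _, (isLocalDefiningFunction_ball (hne x hx).1).1⟩
  have key := integral_kernel_flux (W := ℝ) (c := 1) (g := fun _ => 1) (X := 0) (Ω := univ)
    (P := fun α => (ContinuousLinearMap.lsmul ℝ ℝ : ℝ →L[ℝ] ℝ →L[ℝ] ℝ) ∘L
      (EuclideanSpace.proj α : V p →L[ℝ] ℝ)) hp Metric.isOpen_ball Metric.isBounded_ball hs
    isOpen_univ (subset_univ _)
    (by
      intro v w
      simp only [ContinuousLinearMap.comp_apply, ContinuousLinearMap.lsmul_apply,
        PiLp.proj_apply, smul_eq_mul, one_mul, EuclideanSpace.real_norm_sq_eq, Finset.sum_mul]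
      exact Finset.sum_congr rfl fun i _ => by ring)
    (differentiableOn_const _) (fun Y _ v => by simp)
    (Metric.mem_ball_self one_pos)
  have hfl : ∀ x ∈ frontier (Metric.ball (0 : V p) 1), flux (Metric.ball (0 : V p) 1)
      (fun α Y => (‖Y - 0‖ ^ (4 * p))⁻¹ • ((ContinuousLinearMap.lsmul ℝ ℝ : ℝ →L[ℝ] ℝ →L[ℝ] ℝ) ∘L
        (EuclideanSpace.proj α : V p →L[ℝ] ℝ)) (Y - 0) (1 : ℝ)) x = 1 := by
    intro x hx
    obtain ⟨h0, h1⟩ := hne x hx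
    obtain ⟨hd, hg⟩ := isLocalDefiningFunction_ball h0
    have hν : outwardNormal (Metric.ball (0 : V p) 1) x = x := by
      rw [outwardNormal_eq hd Metric.isOpen_ball hx, hg, norm_smul, h1, smul_smul]
      simp
    simp only [flux, hν, sub_zero, h1, one_pow, inv_one, one_mul,
      ContinuousLinearMap.comp_apply, ContinuousLinearMap.lsmul_apply, PiLp.proj_apply,
      smul_eq_mul, mul_one]
    have := EuclideanSpace.real_norm_sq_eq x
    rw [h1, one_pow] at this
    exact (Finset.sum_congr rfl fun i _ => (sq (x i)).symm).trans this.symm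
  rw [setIntegral_congr_fun isClosed_frontier.measurableSet hfl] at key
  rw [frontier_ball _ one_ne_zero] at key
  simpa [area, Measure.real] using key

theorem area_pos {p : ℕ} (hp : 1 ≤ p) : 0 < area p := by
  rw [area_eq_peakMass hp]
  exact peakMass_pos hp

/-! ### Indices and coordinates -/

section Coordinates

variable {p : ℕ}

/-- The splitting of the real coordinates into `x_k` and `y_k`. -/
def coordEquiv (p : ℕ) : Fin 2 × Fin (2 * p) ≃ Fin (4 * p) where
  toFun z := ⟨2 * z.2.1 + z.1.1, by omega⟩
  invFun α := (⟨α.1 % 2, by omega⟩, ⟨α.1 / 2, by omega⟩)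
  left_inv z := by ext <;> simp <;> omega
  right_inv α := by ext; simp; omega

/-- The splitting of the complex coordinates into pairs. -/
def pairEquiv (p : ℕ) : Fin 2 × Fin p ≃ Fin (2 * p) where
  toFun z := ⟨2 * z.2.1 + z.1.1, by omega⟩
  invFun α := (⟨α.1 % 2, by omega⟩, ⟨α.1 / 2, by omega⟩)
  left_inv z := by ext <;> simp <;> omega
  right_inv α := by ext; simp; omega

theorem sum_coord {M : Type*} [AddCommMonoid M] (φ : Fin (4 * p) → M) :
    ∑ α, φ α = ∑ k, (φ (xi k) + φ (yi k)) := by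
  rw [← (coordEquiv p).sum_comp, Fintype.sum_prod_type, Fin.sum_univ_two,
    ← Finset.sum_add_distrib]
  rfl

theorem sum_pair {M : Type*} [AddCommMonoid M] (φ : Fin (2 * p) → M) :
    ∑ k, φ k = ∑ j, (φ (fst j) + φ (snd j)) := by
  rw [← (pairEquiv p).sum_comp, Fintype.sum_prod_type, Fin.sum_univ_two,
    ← Finset.sum_add_distrib]
  rfl

theorem xi_inj {k l : Fin (2 * p)} : (xi k : Fin (4 * p)) = xi l ↔ k = l := by
  simp [xi, Fin.ext_iff]

theorem yi_inj {k l : Fin (2 * p)} : (yi k : Fin (4 * p)) = yi l ↔ k = l := by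
  simp [yi, Fin.ext_iff]

theorem xi_ne_yi (k l : Fin (2 * p)) : (xi k : Fin (4 * p)) ≠ yi l := by
  simp [xi, yi, Fin.ext_iff]; omega

theorem zc_apply (k : Fin (2 * p)) (v : V p) :
    zc k v = (v (xi k) : ℂ) + Complex.I * (v (yi k) : ℂ) := rfl

theorem zcc_apply (k : Fin (2 * p)) (v : V p) :
    zcc k v = (v (xi k) : ℂ) - Complex.I * (v (yi k) : ℂ) := rfl

theorem zc_single_xi (k l : Fin (2 * p)) :
    zc k (EuclideanSpace.single (xi l) (1 : ℝ)) = if k = l then 1 else 0 := by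
  simp only [zc_apply, PiLp.single_apply, xi_inj, (xi_ne_yi l k).symm, if_false]
  split_ifs <;> simp

theorem zc_single_yi (k l : Fin (2 * p)) :
    zc k (EuclideanSpace.single (yi l) (1 : ℝ)) = if k = l then Complex.I else 0 := by
  simp only [zc_apply, PiLp.single_apply, yi_inj, xi_ne_yi k l, if_false]
  split_ifs <;> simp

theorem zcc_single_xi (k l : Fin (2 * p)) :
    zcc k (EuclideanSpace.single (xi l) (1 : ℝ)) = if k = l then 1 else 0 := by
  simp only [zcc_apply, PiLp.single_apply, xi_inj, (xi_ne_yi l k).symm, if_false]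
  split_ifs <;> simp

theorem zcc_single_yi (k l : Fin (2 * p)) :
    zcc k (EuclideanSpace.single (yi l) (1 : ℝ)) = if k = l then -Complex.I else 0 := by
  simp only [zcc_apply, PiLp.single_apply, yi_inj, xi_ne_yi k l, if_false]
  split_ifs <;> simp

theorem zc_mul_zcc (k : Fin (2 * p)) (v : V p) :
    zc k v * zcc k v = ((v (xi k) ^ 2 + v (yi k) ^ 2 : ℝ) : ℂ) := by
  rw [zc_apply, zcc_apply]
  push_cast
  linear_combination (-(v (yi k) : ℂ) ^ 2) * Complex.I_sq

theorem sum_zc_mul_zcc (v : V p) : ∑ k, zc k v * zcc k v = ((‖v‖ ^ 2 : ℝ) : ℂ) := by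
  rw [EuclideanSpace.real_norm_sq_eq, sum_coord]
  simp only [zc_mul_zcc]
  push_cast
  rfl

end Coordinates

/-! ### The densities of the forms -/

section Density

variable {p : ℕ}

theorem skip_eq_succAbove {n : ℕ} (j : Fin (n + 1)) (i : Fin n) :
    skip j i = j.succAbove i := by
  ext
  simp only [skip, Fin.succAbove, Fin.lt_def, Fin.val_castSucc]
  split_ifs <;> simp

/-- The minor without row `i` and column `α` is, up to the sign `(-1)^{i+α}`, the entry `(α, i)` of
the adjugate. -/
theorem sum_sign_mul_det_skip {m : ℕ} (M : Matrix (Fin m) (Fin m) ℂ) (ν : Fin m → ℂ) (i : Fin m) :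
    ∑ α : Fin m, ((-1 : ℂ) ^ (α : ℕ) * ν α) *
        Matrix.det (Matrix.of fun a b => M (skip i a) (skip α b)) =
      (-1) ^ (i : ℕ) * (Matrix.vecMul ν M.adjugate) i := by
  rcases m with _ | n
  · exact i.elim0
  rw [Matrix.vecMul, dotProduct, Finset.mul_sum]
  refine Finset.sum_congr rfl fun α _ => ?_
  rw [Matrix.adjugate_fin_succ_eq_det_submatrix]
  have e : (Matrix.of fun a b => M (skip i a) (skip α b)) =
      M.submatrix i.succAbove α.succAbove := by
    ext a b
    exact congrArg₂ M (skip_eq_succAbove i a) (skip_eq_succAbove α b)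
  change _ * Matrix.det (n := Fin n) _ = _
  erw [e]
  have hs : ((-1 : ℂ) ^ (i : ℕ)) * (-1) ^ (i : ℕ) = 1 := by
    rw [← mul_pow]; simp
  rw [pow_add]
  linear_combination (-((-1 : ℂ) ^ (α : ℕ) * ν α) *
    (M.submatrix i.succAbove α.succAbove).det) * hs

/-- The matrix of the forms `dz_1, dz_1^c, …` in the standard basis. -/
def dzMatrix (p : ℕ) : Matrix (Fin (4 * p)) (Fin (4 * p)) ℂ :=
  Matrix.of fun a β => dzSeq a (EuclideanSpace.single β (1 : ℝ))

theorem dzSeq_xi (k : Fin (2 * p)) : dzSeq (xi k) = zc k := by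
  have h : (xi k : Fin (4 * p)).1 % 2 = 0 := by simp [xi]
  rw [dzSeq, if_pos h]
  congr 1
  ext
  simp [xi]

theorem dzSeq_yi (k : Fin (2 * p)) : dzSeq (yi k) = zcc k := by
  have h : ¬(yi k : Fin (4 * p)).1 % 2 = 0 := by simp [yi]
  rw [dzSeq, if_neg h]
  congr 1
  ext
  simp [yi]
  omega

/-- There are `2p` diagonal blocks of determinant `-2i`, and `(-2i)² = -4`. This is the origin of
the factor `(-4)^p`. -/
theorem det_dzMatrix (p : ℕ) : (dzMatrix p).det = (-4 : ℂ) ^ p := by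
  have h : (dzMatrix p).submatrix (coordEquiv p) (coordEquiv p) =
      Matrix.blockDiagonal fun _ : Fin (2 * p) => !![1, Complex.I; 1, -Complex.I] := by
    ext ⟨a, k⟩ ⟨b, l⟩
    rw [Matrix.blockDiagonal_apply]
    fin_cases a <;> fin_cases b
    · change dzSeq (xi k) (EuclideanSpace.single (xi l) (1 : ℝ)) = _
      rw [dzSeq_xi, zc_single_xi]; simp
    · change dzSeq (xi k) (EuclideanSpace.single (yi l) (1 : ℝ)) = _
      rw [dzSeq_xi, zc_single_yi]; simp
    · change dzSeq (yi k) (EuclideanSpace.single (xi l) (1 : ℝ)) = _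
      rw [dzSeq_yi, zcc_single_xi]; simp
    · change dzSeq (yi k) (EuclideanSpace.single (yi l) (1 : ℝ)) = _
      rw [dzSeq_yi, zcc_single_yi]; simp
  rw [← Matrix.det_submatrix_equiv_self (coordEquiv p), h, Matrix.det_blockDiagonal,
    Finset.prod_const, Finset.card_univ, Fintype.card_fin, Matrix.det_fin_two_of, pow_mul]
  congr 1
  linear_combination 4 * Complex.I_sq

/-- The coefficients of `ν^♭` with respect to `dz_1, dz_1^c, …`. -/
def flatCoeff (ν : V p) (a : Fin (4 * p)) : ℂ :=
  starRingEnd ℂ (dzSeq a ν) / 2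

theorem flatCoeff_xi (ν : V p) (k : Fin (2 * p)) : flatCoeff ν (xi k) = zcc k ν / 2 := by
  rw [flatCoeff, dzSeq_xi, zc_apply, zcc_apply]
  simp [sub_eq_add_neg]

theorem flatCoeff_yi (ν : V p) (k : Fin (2 * p)) : flatCoeff ν (yi k) = zc k ν / 2 := by
  rw [flatCoeff, dzSeq_yi, zc_apply, zcc_apply]
  simp

/-- The inner product with `ν` is `½ ∑ (z_k^c(ν) dz_k + z_k(ν) dz_k^c)`. -/
theorem vecMul_flatCoeff (ν : V p) :
    Matrix.vecMul (flatCoeff ν) (dzMatrix p) = fun β => (ν β : ℂ) := by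
  funext β
  rw [Matrix.vecMul, dotProduct, sum_coord]
  simp only [flatCoeff_xi, flatCoeff_yi, dzMatrix, Matrix.of_apply, dzSeq_xi, dzSeq_yi]
  obtain ⟨⟨b, l⟩, rfl⟩ := (coordEquiv p).surjective β
  fin_cases b
  · change ∑ k, (zcc k ν / 2 * zc k (EuclideanSpace.single (xi l) (1 : ℝ)) +
      zc k ν / 2 * zcc k (EuclideanSpace.single (xi l) (1 : ℝ))) = (ν (xi l) : ℂ)
    simp only [zc_single_xi, zcc_single_xi, mul_ite, mul_one, mul_zero]
    rw [Finset.sum_add_distrib, Finset.sum_ite_eq', Finset.sum_ite_eq']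
    simp only [Finset.mem_univ, if_true, zc_apply, zcc_apply]
    ring
  · change ∑ k, (zcc k ν / 2 * zc k (EuclideanSpace.single (yi l) (1 : ℝ)) +
      zc k ν / 2 * zcc k (EuclideanSpace.single (yi l) (1 : ℝ))) = (ν (yi l) : ℂ)
    simp only [zc_single_yi, zcc_single_yi, mul_ite, mul_zero]
    rw [Finset.sum_add_distrib, Finset.sum_ite_eq', Finset.sum_ite_eq']
    simp only [Finset.mem_univ, if_true, zc_apply, zcc_apply]
    linear_combination (-(ν (yi l) : ℂ)) * Complex.I_sq

/-- The density of a complex valued form. -/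
def scalarDensity (η : TopForm p ℂ) (ν : V p) : ℂ :=
  ∑ α : Fin (4 * p),
    ((-1 : ℂ) ^ (α : ℕ) * (ν α : ℂ)) * η (fun i => EuclideanSpace.single (skip α i) (1 : ℝ))

theorem scalarDensity_omit (i : Fin (4 * p)) (ν : V p) :
    scalarDensity (wedge fun a => dzSeq (skip i a)) ν =
      (-1) ^ (i : ℕ) * ((-4) ^ p * flatCoeff ν i) := by
  have h := sum_sign_mul_det_skip (dzMatrix p) (fun β => (ν β : ℂ)) i
  rw [← vecMul_flatCoeff, Matrix.vecMul_vecMul, Matrix.mul_adjugate, det_dzMatrix,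
    Matrix.vecMul_smul, Matrix.vecMul_one, Pi.smul_apply, smul_eq_mul] at h
  exact h

theorem scalarDensity_hatdz (k : Fin (2 * p)) (ν : V p) :
    scalarDensity (hatdz k) ν = (-4) ^ p / 2 * zcc k ν := by
  rw [hatdz, scalarDensity_omit, flatCoeff_xi]
  simp only [xi, pow_mul, neg_one_sq, one_pow]
  ring

/-- Counting from zero, `dz_k^c` stands at an odd place; the resulting sign is the one compensated
in `dσd` and `dσdJ`. -/
theorem scalarDensity_hatdzc (k : Fin (2 * p)) (ν : V p) :
    scalarDensity (hatdzc k) ν = -((-4) ^ p / 2 * zc k ν) := by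
  rw [hatdzc, scalarDensity_omit, flatCoeff_yi]
  simp only [yi, pow_succ, pow_mul]
  ring

theorem density_tens (a : Cl p) (η : TopForm p ℂ) (ν : V p) :
    density (tens a η) ν = scalarDensity η ν • a := by
  simp only [density, scalarDensity, Finset.sum_smul, mul_smul]
  rfl

theorem density_add (η θ : TopForm p (Cl p)) (ν : V p) :
    density (η + θ) ν = density η ν + density θ ν := by
  simp only [density, AlternatingMap.add_apply, smul_add, Finset.sum_add_distrib]

theorem density_neg (η : TopForm p (Cl p)) (ν : V p) : density (-η) ν = -density η ν := by
  simp only [density, AlternatingMap.neg_apply, smul_neg, Finset.sum_neg_distrib]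

theorem density_sub (η θ : TopForm p (Cl p)) (ν : V p) :
    density (η - θ) ν = density η ν - density θ ν := by
  rw [sub_eq_add_neg, density_add, density_neg, sub_eq_add_neg]

theorem density_sum {ι : Type*} (s : Finset ι) (η : ι → TopForm p (Cl p)) (ν : V p) :
    density (∑ i ∈ s, η i) ν = ∑ i ∈ s, density (η i) ν := by
  classical
  induction s using Finset.induction_on with
  | empty => simp [density]
  | insert i s hi ih => rw [Finset.sum_insert hi, density_add, ih, Finset.sum_insert hi]

theorem density_sandwich (a b : Cl p) (η : TopForm p (Cl p)) (ν : V p) :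
    density (sandwich a η b) ν = a * density η ν * b := by
  simp only [density, Finset.mul_sum, Finset.sum_mul, mul_smul_comm, smul_mul_assoc]
  rfl

/-- The roles cross: `dσ` yields `z†` of the normal, while `dσd` yields `z`. Hence `E dσ + E† dσd`
involves the mixed products. -/
theorem density_dσ (ν : V p) : density (dσ p) ν = ((-4 : ℂ) ^ p / 2) • hzd ν := by
  simp only [dσ, density_sum, density_tens, scalarDensity_hatdz, hzd, Finset.smul_sum, mul_smul]

theorem density_dσd (ν : V p) : density (dσd p) ν = ((-4 : ℂ) ^ p / 2) • hz ν := by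
  simp only [dσd, density_neg, density_sum, density_tens, scalarDensity_hatdzc, hz,
    Finset.smul_sum, mul_smul, neg_smul, Finset.sum_neg_distrib, neg_neg]

theorem density_dσJ (ν : V p) : density (dσJ p) ν = ((-4 : ℂ) ^ p / 2) • hzdJ ν := by
  simp only [dσJ, density_sum, density_sub, density_tens, scalarDensity_hatdz, hzdJ,
    Finset.smul_sum, mul_smul, smul_sub]

theorem density_dσdJ (ν : V p) : density (dσdJ p) ν = ((-4 : ℂ) ^ p / 2) • hzJ ν := by
  simp only [dσdJ, density_neg, density_sum, density_sub, density_tens, scalarDensity_hatdzc,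
    hzJ, Finset.smul_sum, mul_smul, smul_sub, neg_smul, ← Finset.sum_neg_distrib]
  exact Finset.sum_congr rfl fun j _ => by abel

end Density

/-! ### Relations in the Clifford algebra -/

section Witt

variable {p : ℕ}

theorem e_mul_e_add_swap (α β : Fin (4 * p)) :
    e α * e β + e β * e α = (if α = β then (-2 : ℂ) else 0) • (1 : Cl p) := by
  rw [e, e, CliffordAlgebra.ι_mul_ι_add_swap, Algebra.algebraMap_eq_smul_one]
  congr 1
  simp only [QuadraticMap.polar, negForm, QuadraticMap.weightedSumSquares_apply,
    ← Finset.sum_sub_distrib, Pi.add_apply]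
  split_ifs with h
  · subst h
    rw [Finset.sum_eq_single α]
    · simp; norm_num
    · intro i _ hi; simp [hi]
    · simp
  · refine Finset.sum_eq_zero fun i _ => ?_
    by_cases h1 : i = α
    · subst h1; simp [h]
    · simp [h1]

theorem e_xi_mul_e_yi (k l : Fin (2 * p)) :
    (e (xi k) : Cl p) * e (yi l) = -(e (yi l) * e (xi k)) := by
  have h := e_mul_e_add_swap (xi k) (yi l)
  rw [if_neg (xi_ne_yi k l), zero_smul] at h
  exact eq_neg_of_add_eq_zero_left h

theorem e_xi_mul_e_xi_add_swap (k l : Fin (2 * p)) :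
    (e (xi k) : Cl p) * e (xi l) + e (xi l) * e (xi k) = (if k = l then (-2 : ℂ) else 0) • 1 := by
  rw [e_mul_e_add_swap]; simp only [xi_inj]

theorem e_yi_mul_e_yi_add_swap (k l : Fin (2 * p)) :
    (e (yi k) : Cl p) * e (yi l) + e (yi l) * e (yi k) = (if k = l then (-2 : ℂ) else 0) • 1 := by
  rw [e_mul_e_add_swap]; simp only [yi_inj]

theorem f_mul_fd_add_swap (k l : Fin (2 * p)) :
    f k * fd l + fd l * f k = (if k = l then (1 : ℂ) else 0) • (1 : Cl p) := by
  have hx := e_xi_mul_e_xi_add_swap k l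
  have hy := e_yi_mul_e_yi_add_swap k l
  -- The right side is written as `-1/4` times the sum of the `x`- and `y`-anticommutators, so that
  -- both sides expand into the same products; the mixed terms cancel by anticommutation.
  have h : (if k = l then (1 : ℂ) else 0) • (1 : Cl p) =
      (-(1 / 4) : ℂ) • ((if k = l then (-2 : ℂ) else 0) • (1 : Cl p) +
        (if k = l then (-2 : ℂ) else 0) • (1 : Cl p)) := by
    split_ifs <;> module
  rw [h]
  nth_rewrite 1 [← hx]
  rw [← hy]
  simp only [f, fd, mul_add, add_mul, sub_mul, mul_sub, smul_mul_assoc, mul_smul_comm, smul_add,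
    smul_sub, smul_smul, e_xi_mul_e_yi]
  match_scalars <;> first | ring1 | linear_combination (1 / 4 : ℂ) * Complex.I_sq

/-- The two anticommutators coincide and enter with opposite signs because `i² = -1`. -/
theorem f_mul_f_add_swap (k l : Fin (2 * p)) : f k * f l + f l * f k = (0 : Cl p) := by
  have h := (e_xi_mul_e_xi_add_swap k l).trans (e_yi_mul_e_yi_add_swap k l).symm
  rw [← smul_zero (1 / 4 : ℂ), ← sub_eq_zero.2 h]
  simp only [f, mul_sub, sub_mul, smul_mul_assoc, mul_smul_comm, smul_add,
    smul_sub, smul_smul, e_xi_mul_e_yi]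
  match_scalars <;> first | ring1 | linear_combination (1 / 4 : ℂ) * Complex.I_sq

theorem fd_mul_fd_add_swap (k l : Fin (2 * p)) : fd k * fd l + fd l * fd k = (0 : Cl p) := by
  have h := (e_xi_mul_e_xi_add_swap k l).trans (e_yi_mul_e_yi_add_swap k l).symm
  rw [← smul_zero (1 / 4 : ℂ), ← sub_eq_zero.2 h]
  simp only [fd, mul_add, add_mul, smul_mul_assoc, mul_smul_comm, smul_add,
    smul_sub, smul_smul, e_xi_mul_e_yi]
  match_scalars <;> first | ring1 | linear_combination (1 / 4 : ℂ) * Complex.I_sq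

theorem sum_smul_mul_sum_smul_add_swap {ι R A : Type*} [Fintype ι] [CommSemiring R] [Semiring A]
    [Algebra R A] (a b : ι → R) (u w : ι → A) :
    (∑ k, a k • u k) * (∑ l, b l • w l) + (∑ l, b l • w l) * (∑ k, a k • u k) =
      ∑ k, ∑ l, (a k * b l) • (u k * w l + w l * u k) := by
  rw [Finset.sum_mul_sum, Finset.sum_mul_sum]
  conv_lhs => arg 2; rw [Finset.sum_comm]
  rw [← Finset.sum_add_distrib]
  refine Finset.sum_congr rfl fun k _ => ?_
  rw [← Finset.sum_add_distrib]
  refine Finset.sum_congr rfl fun l _ => ?_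
  rw [smul_mul_smul_comm, smul_mul_smul_comm, mul_comm (b l), smul_add]

theorem sum_f_mul_sum_fd_add_swap (a b : Fin (2 * p) → ℂ) :
    (∑ k, a k • f k) * (∑ l, b l • fd l) + (∑ l, b l • fd l) * (∑ k, a k • f k) =
      (∑ k, a k * b k) • (1 : Cl p) := by
  rw [sum_smul_mul_sum_smul_add_swap, Finset.sum_smul]
  refine Finset.sum_congr rfl fun k _ => ?_
  simp only [f_mul_fd_add_swap, ite_smul, one_smul, zero_smul, smul_ite, smul_zero,
    Finset.sum_ite_eq, Finset.mem_univ, if_true]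

/-- The `𝔣_k` span an isotropic space. This and its conjugate version give `c = 0` in the cross
formulas. -/
theorem sum_f_mul_self (a : Fin (2 * p) → ℂ) :
    (∑ k, a k • f k) * (∑ k, a k • f k) = (0 : Cl p) := by
  have h := sum_smul_mul_sum_smul_add_swap a a (f (p := p)) f
  simp only [f_mul_f_add_swap, smul_zero, Finset.sum_const_zero] at h
  rwa [← two_smul ℂ, smul_eq_zero_iff_right two_ne_zero] at h

theorem sum_fd_mul_self (a : Fin (2 * p) → ℂ) :
    (∑ k, a k • fd k) * (∑ k, a k • fd k) = (0 : Cl p) := by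
  have h := sum_smul_mul_sum_smul_add_swap a a (fd (p := p)) fd
  simp only [fd_mul_fd_add_swap, smul_zero, Finset.sum_const_zero] at h
  rwa [← two_smul ℂ, smul_eq_zero_iff_right two_ne_zero] at h

/-- The family `(a_2, -a_1, a_4, -a_3, …)`. -/
def swapPairs {M : Type*} [Neg M] (a : Fin (2 * p) → M) (k : Fin (2 * p)) : M :=
  if ((pairEquiv p).symm k).1 = 0 then a (snd ((pairEquiv p).symm k).2)
    else -a (fst ((pairEquiv p).symm k).2)

theorem swapPairs_fst {M : Type*} [Neg M] (a : Fin (2 * p) → M) (j : Fin p) :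
    swapPairs a (fst j) = a (snd j) := by
  have h : (pairEquiv p).symm (fst j) = (0, j) := (pairEquiv p).symm_apply_apply (0, j)
  simp [swapPairs, h]

theorem swapPairs_snd {M : Type*} [Neg M] (a : Fin (2 * p) → M) (j : Fin p) :
    swapPairs a (snd j) = -a (fst j) := by
  have h : (pairEquiv p).symm (snd j) = (1, j) := (pairEquiv p).symm_apply_apply (1, j)
  simp [swapPairs, h]

theorem hzJ_eq_sum (v : V p) : hzJ v = ∑ k, swapPairs (fun k => zc k v) k • fd k := by
  rw [sum_pair]
  simp only [hzJ, swapPairs_fst, swapPairs_snd, neg_smul, sub_eq_add_neg]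

theorem hzdJ_eq_sum (v : V p) : hzdJ v = ∑ k, swapPairs (fun k => zcc k v) k • f k := by
  rw [sum_pair]
  simp only [hzdJ, swapPairs_fst, swapPairs_snd, neg_smul, sub_eq_add_neg]

/-- Here the Witt vectors are permuted instead of the coefficients. This form displays the linearity
in `v` and the derivatives, the other one the Witt relations. -/
theorem hzJ_eq_sum_swapPairs (v : V p) : hzJ v = ∑ k, zc k v • -swapPairs fd k := by
  rw [sum_pair]
  refine Finset.sum_congr rfl fun j _ => ?_
  rw [swapPairs_fst, swapPairs_snd]
  module

theorem hzdJ_eq_sum_swapPairs (v : V p) : hzdJ v = ∑ k, zcc k v • -swapPairs f k := by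
  rw [sum_pair]
  refine Finset.sum_congr rfl fun j _ => ?_
  rw [swapPairs_fst, swapPairs_snd]
  module

theorem hz_mul_hzd_add_swap (v : V p) :
    hz v * hzd v + hzd v * hz v = ((‖v‖ ^ 2 : ℝ) : ℂ) • 1 := by
  rw [hz, hzd, sum_f_mul_sum_fd_add_swap, sum_zc_mul_zcc]

/-- The pairwise exchange only permutes the terms `z_k z_k^c`, and its minus signs occur twice. -/
theorem hzJ_mul_hzdJ_add_swap (v : V p) :
    hzJ v * hzdJ v + hzdJ v * hzJ v = ((‖v‖ ^ 2 : ℝ) : ℂ) • 1 := by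
  rw [hzJ_eq_sum, hzdJ_eq_sum, add_comm, sum_f_mul_sum_fd_add_swap, ← sum_zc_mul_zcc, sum_pair,
    sum_pair]
  congr 1
  refine Finset.sum_congr rfl fun j _ => ?_
  rw [swapPairs_fst, swapPairs_fst, swapPairs_snd, swapPairs_snd]
  ring

theorem hz_mul_self_add (v : V p) : hz v * hz v + hzd v * hzd v = 0 := by
  rw [hz, hzd, sum_f_mul_self, sum_fd_mul_self, add_zero]

theorem hzJ_mul_self_add (v : V p) : hzJ v * hzJ v + hzdJ v * hzdJ v = 0 := by
  rw [hzJ_eq_sum, hzdJ_eq_sum, sum_f_mul_self, sum_fd_mul_self, add_zero]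

end Witt

/-! ### The hermitian Dirac operators -/

section HermitianDirac

variable {p : ℕ}

theorem sum_zc_single_mul (b : Fin (2 * p) → Cl p) (q : Fin (4 * p) → Cl p) :
    ∑ α, (∑ k, zc k (EuclideanSpace.single α (1 : ℝ)) • b k) * q α =
      ∑ k, b k * (q (xi k) + Complex.I • q (yi k)) := by
  rw [sum_coord]
  refine Finset.sum_congr rfl fun l _ => ?_
  simp only [zc_single_xi, zc_single_yi, ite_smul, one_smul, zero_smul, Finset.sum_ite_eq',
    Finset.mem_univ, if_true, mul_add, smul_mul_assoc, mul_smul_comm]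

theorem sum_zcc_single_mul (b : Fin (2 * p) → Cl p) (q : Fin (4 * p) → Cl p) :
    ∑ α, (∑ k, zcc k (EuclideanSpace.single α (1 : ℝ)) • b k) * q α =
      ∑ k, b k * (q (xi k) - Complex.I • q (yi k)) := by
  rw [sum_coord]
  refine Finset.sum_congr rfl fun l _ => ?_
  simp only [zcc_single_xi, zcc_single_yi, ite_smul, one_smul, zero_smul, Finset.sum_ite_eq',
    Finset.mem_univ, if_true, mul_add, mul_neg, smul_mul_assoc, mul_smul_comm, neg_smul,
    neg_mul, sub_eq_add_neg]

variable (F : V p → Cl p) (X : V p)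

/-- The left side is the hermitian Dirac operator `∑ 𝔣_k (∂_{x_k} + i ∂_{y_k})`; being a combination
of `∂` and `∂_𝕀`, it annihilates monogenic functions. -/
theorem sum_hz_single_mul_pd :
    ∑ α, hz (EuclideanSpace.single α (1 : ℝ)) * pd α F X =
      (-(1 / 2) : ℂ) • dirac F X + (Complex.I / 2) • diracI F X := by
  simp only [hz, sum_zc_single_mul, dirac, diracI, Finset.smul_sum, ← Finset.sum_add_distrib]
  refine Finset.sum_congr rfl fun k _ => ?_
  simp only [f, smul_mul_assoc, sub_mul, mul_add, mul_smul_comm]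
  match_scalars <;> first | ring1 | linear_combination (1 / 2 : ℂ) * Complex.I_sq

theorem sum_hzd_single_mul_pd :
    ∑ α, hzd (EuclideanSpace.single α (1 : ℝ)) * pd α F X =
      (1 / 2 : ℂ) • dirac F X + (Complex.I / 2) • diracI F X := by
  simp only [hzd, sum_zcc_single_mul, dirac, diracI, Finset.smul_sum, ← Finset.sum_add_distrib]
  refine Finset.sum_congr rfl fun k _ => ?_
  simp only [fd, smul_mul_assoc, add_mul, mul_sub, mul_smul_comm]
  match_scalars <;> first | ring1 | linear_combination (-1 / 2 : ℂ) * Complex.I_sq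

theorem sum_hzJ_single_mul_pd :
    ∑ α, hzJ (EuclideanSpace.single α (1 : ℝ)) * pd α F X =
      (-(1 / 2) : ℂ) • diracJ F X + (Complex.I / 2) • diracK F X := by
  simp only [hzJ_eq_sum_swapPairs, sum_zc_single_mul]
  rw [sum_pair]
  simp only [swapPairs_fst, swapPairs_snd, diracJ, diracK, Finset.smul_sum,
    ← Finset.sum_add_distrib]
  refine Finset.sum_congr rfl fun k _ => ?_
  simp only [fd, smul_mul_assoc, add_mul, mul_add, mul_smul_comm, neg_neg, neg_mul]
  match_scalars <;> first | ring1 | linear_combination (1 / 2 : ℂ) * Complex.I_sq |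
    linear_combination (-1 / 2 : ℂ) * Complex.I_sq

theorem sum_hzdJ_single_mul_pd :
    ∑ α, hzdJ (EuclideanSpace.single α (1 : ℝ)) * pd α F X =
      (1 / 2 : ℂ) • diracJ F X + (Complex.I / 2) • diracK F X := by
  simp only [hzdJ_eq_sum_swapPairs, sum_zcc_single_mul]
  rw [sum_pair]
  simp only [swapPairs_fst, swapPairs_snd, diracJ, diracK, Finset.smul_sum,
    ← Finset.sum_add_distrib]
  refine Finset.sum_congr rfl fun k _ => ?_
  simp only [f, smul_mul_assoc, sub_mul, mul_sub, mul_smul_comm, neg_neg, neg_mul]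
  match_scalars <;> first | ring1 | linear_combination (1 / 2 : ℂ) * Complex.I_sq |
    linear_combination (-1 / 2 : ℂ) * Complex.I_sq

end HermitianDirac

/-! ### The reproducing formulas -/

section Reproducing

variable {p : ℕ}

instance : FiniteDimensional ℂ (Cl p) := Module.Finite.equiv (coords p).symm

instance (priority := high) : SMul ℝ (Cl p) :=
  (NormedSpace.complexToReal : NormedSpace ℝ (Cl p)).toModule.toSMul

instance : FiniteDimensional ℝ (Cl p) := FiniteDimensional.complexToReal (Cl p)

instance : CompleteSpace (Cl p) := FiniteDimensional.complete ℂ (Cl p)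

/-- `hz` as a real linear map. -/
def hzLin (p : ℕ) : V p →ₗ[ℝ] Cl p where
  toFun := hz
  map_add' v w := by simp only [hz, map_add, add_smul, Finset.sum_add_distrib]
  map_smul' r v := by simp only [hz, map_smul, smul_assoc, Finset.smul_sum, RingHom.id_apply]

/-- `hzd` as a real linear map. -/
def hzdLin (p : ℕ) : V p →ₗ[ℝ] Cl p where
  toFun := hzd
  map_add' v w := by simp only [hzd, map_add, add_smul, Finset.sum_add_distrib]
  map_smul' r v := by simp only [hzd, map_smul, smul_assoc, Finset.smul_sum, RingHom.id_apply]

/-- `hzJ` as a real linear map. -/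
def hzJLin (p : ℕ) : V p →ₗ[ℝ] Cl p where
  toFun := hzJ
  map_add' v w := by
    simp only [hzJ_eq_sum_swapPairs, map_add, add_smul, Finset.sum_add_distrib]
  map_smul' r v := by
    simp only [hzJ_eq_sum_swapPairs, map_smul, smul_assoc, Finset.smul_sum, RingHom.id_apply]

/-- `hzdJ` as a real linear map. -/
def hzdJLin (p : ℕ) : V p →ₗ[ℝ] Cl p where
  toFun := hzdJ
  map_add' v w := by
    simp only [hzdJ_eq_sum_swapPairs, map_add, add_smul, Finset.sum_add_distrib]
  map_smul' r v := by
    simp only [hzdJ_eq_sum_swapPairs, map_smul, smul_assoc, Finset.smul_sum, RingHom.id_apply]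

/-- The bilinear map `(v, w) ↦ (A₁(v) B₁(ε_α) + A₂(v) B₂(ε_α)) w`. -/
def kernelMap (A₁ B₁ A₂ B₂ : V p →ₗ[ℝ] Cl p) (α : Fin (4 * p)) : V p →L[ℝ] Cl p →L[ℝ] Cl p :=
  LinearMap.toContinuousBilinearMap <| LinearMap.mk₂ ℝ
    (fun v w => (A₁ v * B₁ (EuclideanSpace.single α 1) +
      A₂ v * B₂ (EuclideanSpace.single α 1)) * w)
    (fun v v' w => by simp only [map_add]; noncomm_ring)
    (fun r v w => by
      rw [A₁.map_smul, A₂.map_smul]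
      simp only [smul_mul_assoc, ← smul_add])
    (fun v w w' => mul_add _ _ _)
    (fun r v w => mul_smul_comm _ _ _)

variable {A₁ B₁ A₂ B₂ : V p →ₗ[ℝ] Cl p}

theorem kernelMap_apply (α : Fin (4 * p)) (v : V p) (w : Cl p) :
    kernelMap A₁ B₁ A₂ B₂ α v w = (A₁ v * B₁ (EuclideanSpace.single α 1) +
      A₂ v * B₂ (EuclideanSpace.single α 1)) * w := rfl

theorem sum_smul_map_single (B : V p →ₗ[ℝ] Cl p) (u : V p) :
    ∑ α, u α • B (EuclideanSpace.single α 1) = B u := by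
  conv_rhs => rw [← (EuclideanSpace.basisFun (Fin (4 * p)) ℝ).sum_repr u]
  rw [map_sum]
  exact Finset.sum_congr rfl fun α _ => by simp

theorem sum_smul_kernelMap (u v : V p) (w : Cl p) :
    ∑ α, u α • kernelMap A₁ B₁ A₂ B₂ α v w = (A₁ v * B₁ u + A₂ v * B₂ u) * w := by
  rw [← sum_smul_map_single B₁ u, ← sum_smul_map_single B₂ u, Finset.mul_sum, Finset.mul_sum,
    ← Finset.sum_add_distrib, Finset.sum_mul]
  refine Finset.sum_congr rfl fun α _ => ?_
  rw [kernelMap_apply, mul_smul_comm, mul_smul_comm, ← smul_add, smul_mul_assoc]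

variable {D Ω : Set (V p)} {g : V p → Cl p} {X : V p} {c : ℝ}

/-- The factors `A_i(v)` stand to the left of `B_i(ε_α) ∂_α g`, so the equations for `g` pass to the
system defined by `kernelMap`. -/
theorem integral_kernelMap (hp : 1 ≤ p) (hD : IsOpen D) (hb : Bornology.IsBounded D)
    (hs : HasSmoothBoundary D) (hΩ : IsOpen Ω) (hDΩ : closure D ⊆ Ω)
    (hg : DifferentiableOn ℝ g Ω) (hX : X ∈ D)
    (hAB : ∀ v, A₁ v * B₁ v + A₂ v * B₂ v = ((c * ‖v‖ ^ 2 : ℝ) : ℂ) • 1)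
    (h₁ : ∀ Y ∈ Ω, ∑ α, B₁ (EuclideanSpace.single α 1) * pd α g Y = 0)
    (h₂ : ∀ Y ∈ Ω, ∑ α, B₂ (EuclideanSpace.single α 1) * pd α g Y = 0) :
    IntegrableOn (fun Y => (‖Y - X‖ ^ (4 * p))⁻¹ • ((A₁ (Y - X) * B₁ (outwardNormal D Y) +
      A₂ (Y - X) * B₂ (outwardNormal D Y)) * g Y)) (frontier D) μHE[4 * p - 1] ∧
    ∫ Y in frontier D, (‖Y - X‖ ^ (4 * p))⁻¹ • ((A₁ (Y - X) * B₁ (outwardNormal D Y) +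
      A₂ (Y - X) * B₂ (outwardNormal D Y)) * g Y) ∂μHE[4 * p - 1] = (c * area p) • g X := by
  have hflux : (fun Y => (‖Y - X‖ ^ (4 * p))⁻¹ • ((A₁ (Y - X) * B₁ (outwardNormal D Y) +
      A₂ (Y - X) * B₂ (outwardNormal D Y)) * g Y)) =
      flux D fun α Y => (‖Y - X‖ ^ (4 * p))⁻¹ • kernelMap A₁ B₁ A₂ B₂ α (Y - X) (g Y) := by
    funext Y
    rw [← sum_smul_kernelMap, flux, Finset.smul_sum]
    exact Finset.sum_congr rfl fun α _ => smul_comm _ _ _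
  have hgf : ContinuousOn g (frontier D) :=
    hg.continuousOn.mono (frontier_subset_closure.trans hDΩ)
  rw [hflux]
  refine ⟨integrableOn_frontier hp hD hb hs (continuousOn_kernel_flux hD hs hgf hX), ?_⟩
  rw [area_eq_peakMass hp]
  refine integral_kernel_flux hp hD hb hs hΩ hDΩ (fun v w => ?_) hg (fun Y hY v => ?_) hX
  · rw [sum_smul_kernelMap, hAB, smul_mul_assoc, one_mul, Complex.coe_smul]
  · have h : ∀ α, kernelMap A₁ B₁ A₂ B₂ α v (fderiv ℝ g Y (EuclideanSpace.single α 1)) =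
        A₁ v * (B₁ (EuclideanSpace.single α 1) * pd α g Y) +
          A₂ v * (B₂ (EuclideanSpace.single α 1) * pd α g Y) := fun α => by
      rw [kernelMap_apply, add_mul, mul_assoc, mul_assoc, pd]
    rw [Finset.sum_congr rfl fun α _ => h α, Finset.sum_add_distrib, ← Finset.mul_sum,
      ← Finset.mul_sum, h₁ Y hY, h₂ Y hY, mul_zero, mul_zero, add_zero]

theorem density_sandwich_kerFactor {η : TopForm p (Cl p)} {ν : V p} {β : Cl p}
    (hη : density η ν = ((-4 : ℂ) ^ p / 2) • β) (v : V p) (a b : Cl p) :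
    density (sandwich (kerFactor v • a) η b) ν =
      ((-4 : ℂ) ^ p / area p) • ((‖v‖ ^ (4 * p))⁻¹ • (a * β * b)) := by
  rw [density_sandwich, hη, ← Complex.coe_smul, smul_mul_smul_comm, smul_mul_assoc, smul_smul]
  congr 1
  rw [kerFactor]
  push_cast
  ring

/-- The constants `2 / a_{4p}` of the kernel and `(-4)^p / 2` of the form combine with the mass `c ·
a_{4p}` to `(-4)^p c`. -/
theorem boundaryIntegral_sandwich (hp : 1 ≤ p) (hD : IsOpen D) (hb : Bornology.IsBounded D)
    (hs : HasSmoothBoundary D) (hΩ : IsOpen Ω) (hDΩ : closure D ⊆ Ω)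
    (hg : DifferentiableOn ℝ g Ω) (hX : X ∈ D)
    (hAB : ∀ v, A₁ v * B₁ v + A₂ v * B₂ v = ((c * ‖v‖ ^ 2 : ℝ) : ℂ) • 1)
    (h₁ : ∀ Y ∈ Ω, ∑ α, B₁ (EuclideanSpace.single α 1) * pd α g Y = 0)
    (h₂ : ∀ Y ∈ Ω, ∑ α, B₂ (EuclideanSpace.single α 1) * pd α g Y = 0)
    {η₁ η₂ : TopForm p (Cl p)} (hη₁ : ∀ ν, density η₁ ν = ((-4 : ℂ) ^ p / 2) • B₁ ν)
    (hη₂ : ∀ ν, density η₂ ν = ((-4 : ℂ) ^ p / 2) • B₂ ν) :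
    BoundaryIntegrable D (fun Y => sandwich (kerFactor (Y - X) • A₁ (Y - X)) η₁ (g Y) +
      sandwich (kerFactor (Y - X) • A₂ (Y - X)) η₂ (g Y)) ∧
    boundaryIntegral D (fun Y => sandwich (kerFactor (Y - X) • A₁ (Y - X)) η₁ (g Y) +
      sandwich (kerFactor (Y - X) • A₂ (Y - X)) η₂ (g Y)) = ((-4 : ℂ) ^ p * c) • g X := by
  obtain ⟨hi, hv⟩ := integral_kernelMap hp hD hb hs hΩ hDΩ hg hX hAB h₁ h₂
  simp only [BoundaryIntegrable, boundaryIntegral, density_add,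
    density_sandwich_kerFactor (hη₁ _), density_sandwich_kerFactor (hη₂ _),
    ← smul_add, ← add_mul]
  refine ⟨hi.smul ((-4 : ℂ) ^ p / area p), ?_⟩
  rw [integral_smul, hv, ← Complex.coe_smul, smul_smul]
  congr 1
  have ha : (area p : ℂ) ≠ 0 := Complex.ofReal_ne_zero.2 (area_pos hp).ne'
  push_cast
  field_simp

end Reproducing

end QuatClifford

end

/-! ### The four boundary formulas -/

theorem mainTheorem2 (p : ℕ) (hp : 1 ≤ p)
    (D : Set (QuatClifford.V p)) (hD_open : IsOpen D) (hD_conn : IsConnected D)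
    (hD_bdd : Bornology.IsBounded D) (hD_smooth : QuatClifford.HasSmoothBoundary D)
    (Ω : Set (QuatClifford.V p)) (hΩ : IsOpen Ω) (hDΩ : closure D ⊆ Ω)
    (g : QuatClifford.V p → QuatClifford.Cl p)
    (hg : QuatClifford.QuaternionicMonogenicOn g Ω)
    (X : QuatClifford.V p) (hX : X ∈ interior D) :
    (QuatClifford.BoundaryIntegrable D (QuatClifford.reproForm g X) ∧
      g X = (1 / (-4 : ℂ) ^ p) •
        QuatClifford.boundaryIntegral D (QuatClifford.reproForm g X)) ∧
    (QuatClifford.BoundaryIntegrable D (QuatClifford.reproFormJ g X) ∧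
      g X = (1 / (-4 : ℂ) ^ p) •
        QuatClifford.boundaryIntegral D (QuatClifford.reproFormJ g X)) ∧
    (QuatClifford.BoundaryIntegrable D (QuatClifford.crossForm g X) ∧
      QuatClifford.boundaryIntegral D (QuatClifford.crossForm g X) = 0) ∧
    (QuatClifford.BoundaryIntegrable D (QuatClifford.crossFormJ g X) ∧
      QuatClifford.boundaryIntegral D (QuatClifford.crossFormJ g X) = 0) := by
  open QuatClifford in
  have hz0 : ∀ Y ∈ Ω, ∑ α, hzLin p (EuclideanSpace.single α 1) * pd α g Y = 0 := fun Y hY =>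
    (sum_hz_single_mul_pd g Y).trans (by
      rw [hg.dirac_eq_zero Y hY, hg.diracI_eq_zero Y hY, smul_zero, smul_zero, add_zero])
  have hzd0 : ∀ Y ∈ Ω, ∑ α, hzdLin p (EuclideanSpace.single α 1) * pd α g Y = 0 := fun Y hY =>
    (sum_hzd_single_mul_pd g Y).trans (by
      rw [hg.dirac_eq_zero Y hY, hg.diracI_eq_zero Y hY, smul_zero, smul_zero, add_zero])
  have hzJ0 : ∀ Y ∈ Ω, ∑ α, hzJLin p (EuclideanSpace.single α 1) * pd α g Y = 0 := fun Y hY =>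
    (sum_hzJ_single_mul_pd g Y).trans (by
      rw [hg.diracJ_eq_zero Y hY, hg.diracK_eq_zero Y hY, smul_zero, smul_zero, add_zero])
  have hzdJ0 : ∀ Y ∈ Ω, ∑ α, hzdJLin p (EuclideanSpace.single α 1) * pd α g Y = 0 := fun Y hY =>
    (sum_hzdJ_single_mul_pd g Y).trans (by
      rw [hg.diracJ_eq_zero Y hY, hg.diracK_eq_zero Y hY, smul_zero, smul_zero, add_zero])
  have hXD : X ∈ D := interior_subset hX
  have h4 : (1 / (-4 : ℂ) ^ p) * ((-4) ^ p * ((1 : ℝ) : ℂ)) = 1 := by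
    have : (-4 : ℂ) ^ p ≠ 0 := pow_ne_zero _ (by norm_num)
    push_cast
    field_simp
  -- The normal enters through `z†` next to `E` and through `z` next to `E†`, so the mixed Witt
  -- relation applies with `c = 1`.
  obtain ⟨ir, vr⟩ := boundaryIntegral_sandwich (A₁ := hzLin p) (A₂ := hzdLin p) (c := 1)
    hp hD_open hD_bdd hD_smooth hΩ hDΩ hg.differentiableOn hXD
    (fun v => by rw [one_mul]; exact hz_mul_hzd_add_swap v) hzd0 hz0 density_dσ density_dσd
  obtain ⟨iJ, vJ⟩ := boundaryIntegral_sandwich (A₁ := hzJLin p) (A₂ := hzdJLin p) (c := 1)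
    hp hD_open hD_bdd hD_smooth hΩ hDΩ hg.differentiableOn hXD
    (fun v => by rw [one_mul]; exact hzJ_mul_hzdJ_add_swap v) hzdJ0 hzJ0 density_dσJ density_dσdJ
  -- With the forms exchanged, `z` meets `z` and `z†` meets `z†`; both squares vanish and `c = 0`.
  obtain ⟨ic, vc⟩ := boundaryIntegral_sandwich (A₁ := hzLin p) (A₂ := hzdLin p) (c := 0)
    hp hD_open hD_bdd hD_smooth hΩ hDΩ hg.differentiableOn hXD
    (fun v => by
      rw [zero_mul, Complex.ofReal_zero, zero_smul]; exact hz_mul_self_add v)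
    hz0 hzd0 density_dσd density_dσ
  obtain ⟨iK, vK⟩ := boundaryIntegral_sandwich (A₁ := hzJLin p) (A₂ := hzdJLin p) (c := 0)
    hp hD_open hD_bdd hD_smooth hΩ hDΩ hg.differentiableOn hXD
    (fun v => by
      rw [zero_mul, Complex.ofReal_zero, zero_smul]; exact hzJ_mul_self_add v)
    hzJ0 hzdJ0 density_dσdJ density_dσJ
  rw [Complex.ofReal_zero, mul_zero, zero_smul] at vc vK
  refine ⟨⟨ir, ?_⟩, ⟨iJ, ?_⟩, ⟨ic, vc⟩, ⟨iK, vK⟩⟩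
  · refine ((congrArg _ vr).trans ?_).symm
    rw [smul_smul, h4, one_smul]
  · refine ((congrArg _ vJ).trans ?_).symm
    rw [smul_smul, h4, one_smul]
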